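/- Metrics are allowed to take the value $+\infty$. A metric space $X$ has *bounded geometry* if for each $R>0$ there is $N\in\mathbb N$ such that every ball of radius $R$ in $X$ has at most $N$ points. For a bounded operator $T$ on $\ell^2(X)$ (complex coefficients, Dirac masses $\delta_x$) put $T_{xy}=\langle\delta_x,T\delta_y\rangle$ and $\operatorname{Prop}(T)=\sup\{d(x,y) : T_{xy}\neq 0\}$. The *uniform Roe algebra* $C^*_u(X)$ is the operator-norm closure of $\{T : \operatorname{Prop}(T)<\infty\}$. A *ghost* is an operator $T\in C^*_u(X)$ such that $T_{xy}\to 0$ as $x,y\to\infty$, i.e. for each $\varepsilon>0$ there is a finite $F\subseteq X$ with $|T_{xy}|<\varepsilon$ for all $x,y\in X\setminus F$. The space $X$ has *property A* if there is a sequence $(k_n)$ of real-valued positive definite kernels on $X\times X$ (that is, $k_n$ is symmetric and $\sum_{i,j}c_ic_jk_n(x_i,x_j)\ge 0$ for all finitely many $x_i\in X$, $c_i\in\mathbb R$) such that (a) for each $n$ there is $r\geq 0$ with $k_n(x,y)=0$ whenever $d(x,y)>r$; (b) for all $s>0$ and $\varepsilon>0$ there is $N$ such that $1-\varepsilon\le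 k_n(x,y)\le 1$ for all $n>N$ and all $x,y$ with $d(x,y)<s$. **Theorem.** Let $X$ be a bounded geometry metric space. If $X$ does not have property A, then there is a non-compact ghost operator in $C^*_u(X)$. That is, $X$ has property A if and only if every ghost operator in $C^*_u(X)$ is compact. -/

import Mathlib

open Filter Topology
open scoped NNReal ENNReal

noncomputable section

namespace RoeAlg

/-- A metric space (distances may be `∞`) has bounded geometry if for each radius `R > 0` there is
a uniform bound on the number of points of the balls of radius `R`. -/
def BoundedGeometry (X : Type*) [EMetricSpace X] : Prop :=
  ∀ R : ℝ≥0, 0 < R → ∃ N : ℕ, ∀ x : X, {y : X | edist y x < (R : ℝ≥0∞)}.encard ≤ (N : ℕ∞)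

/-- The Hilbert space of square summable complex functions on `X`. -/
abbrev L2 (X : Type*) : Type _ := lp (fun _ : X => ℂ) 2

open Classical in
/-- The Dirac mass at `x`, an element of the standard orthonormal basis of `ℓ²(X)`. -/
def dirac {X : Type*} (x : X) : L2 X := lp.single 2 x (1 : ℂ)

/-- The matrix entry `T_{xy} = ⟨δ_x, T δ_y⟩` (the inner product is linear in the second slot). -/
def entry {X : Type*} (T : L2 X →L[ℂ] L2 X) (x y : X) : ℂ := inner ℂ (dirac x) (T (dirac y))

/-- The propagation `sup {d(x,y) | T_{xy} ≠ 0}`, with values in `[0, ∞]`. -/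
def propagation {X : Type*} [EMetricSpace X] (T : L2 X →L[ℂ] L2 X) : ℝ≥0∞ :=
  sSup {r : ℝ≥0∞ | ∃ x y : X, entry T x y ≠ 0 ∧ r = edist x y}

/-- The bounded operators on `ℓ²(X)` of propagation at most `R`. -/
def propagationLE (X : Type*) [EMetricSpace X] (R : ℝ≥0) : Set (L2 X →L[ℂ] L2 X) :=
  {T | propagation T ≤ (R : ℝ≥0∞)}

/-- The underlying set of the uniform Roe algebra of `X`: the operator norm closure of the set of
bounded operators of finite propagation. -/
def uniformRoe (X : Type*) [EMetricSpace X] : Set (L2 X →L[ℂ] L2 X) :=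
  closure (⋃ R : ℝ≥0, propagationLE X R)

/-- A ghost is an element of the uniform Roe algebra with `T_{xy} → 0` as `x, y → ∞`, i.e. as
`x` and `y` leave every finite subset of `X` (in a bounded geometry space with finite distances
these are the bounded subsets). -/
def IsGhost {X : Type*} [EMetricSpace X] (T : L2 X →L[ℂ] L2 X) : Prop :=
  T ∈ uniformRoe X ∧
    Tendsto (fun p : X × X => entry T p.1 p.2) (cofinite ×ˢ cofinite) (𝓝 0)

/-- Property A: there is a sequence of positive definite kernels `k n`, each of controlled support,
tending to `1` uniformly on each controlled set. (`Matrix.PosSemidef` for the possibly infinite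
index type `X` says that `k n` is symmetric and that `∑ i j, c i * k n i j * c j ≥ 0` for all
finitely supported `c`.) -/
def PropertyA (X : Type*) [EMetricSpace X] : Prop :=
  ∃ k : ℕ → Matrix X X ℝ,
    (∀ n, (k n).PosSemidef) ∧
    (∀ n, ∃ r : ℝ≥0, ∀ x y : X, (r : ℝ≥0∞) < edist x y → k n x y = 0) ∧
    (∀ s : ℝ≥0, 0 < s → ∀ ε : ℝ, 0 < ε → ∃ N : ℕ, ∀ n, N < n → ∀ x y : X,
      edist x y < (s : ℝ≥0∞) → 1 - ε ≤ k n x y ∧ k n x y ≤ 1)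

end RoeAlg

end

noncomputable section

namespace RoeAlg

/-! ### Matrix entries of operators on `ℓ²(X)` -/

section Entries

variable {X : Type*}

/-! Suppose property A holds. A kernel close to 1 on the band of a finite propagation approximant
acts as a contractive Schur multiplier, so it turns a ghost into a nearby ghost of finite
propagation. Off finitely many rows and columns such a ghost has uniformly small entries, hence
small norm by bounded geometry, so it is compact (`BoundedGeometry.isCompactOperator_of_isGhost`).

Suppose property A fails. A compactness argument and a gluing across finite sets give, for some
fixed `r` and `ε`, disjoint finite sets `F n` without kernels of locality `r + n`
(`BoundedGeometry.exists_disjoint_of_not_propertyA`). On each of them Hahn-Banach yields a dual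
certificate. After rescaling it is a symmetric matrix `t n` with nonnegative entries and propagation
at most `r`. Its quadratic form is at most `‖v‖²` on vectors supported in sets of diameter at most
`r + n`, yet at least `(1 + ε/2)‖u‖²` at some vector `u n` (`exists_matrix_of_not_hasLocalKernel`).

Let `T` be the block sum of the `t n`. The powers of `T` move a Dirac mass in `F n` slowly, so only
localized vectors are seen and `‖T ^ m δ_x‖ ≤ 1` while `2mr ≤ r + n` (`norm_pow_dirac_le_one`).
Dirac masses far out thus see a contraction, although `T` has a quadratic form above 1 at every `u
n`. The cutoff `G = (T - κ)₊` with `κ = 1 + ε/4` exploits this (`exists_posPart_sub`). Since `G = H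
T ^ m` with `‖H‖` of order `κ⁻ᵐ`, far columns of `G` are small and `G` is a ghost. Since `G ≥ T -
κ`, it is bounded below by `ε/4` on the normalized `u n`, which are orthonormal, so `G` is not
compact. -/

lemma inner_dirac_left (x : X) (f : L2 X) : inner ℂ (dirac x) f = f x := by
  simp [dirac, lp.inner_single_left]

lemma entry_eq_apply (T : L2 X →L[ℂ] L2 X) (x y : X) : entry T x y = T (dirac y) x :=
  inner_dirac_left _ _

lemma dirac_apply [DecidableEq X] (x y : X) : (dirac x : L2 X) y = if y = x then 1 else 0 := by
  by_cases h : y = x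
  · subst h
    rw [dirac, @lp.single_apply_self, if_pos rfl]
  · rw [dirac, @lp.single_apply_ne (hij := h), if_neg h]

@[simp] lemma norm_dirac (x : X) : ‖(dirac x : L2 X)‖ = 1 := by
  classical
  simp [dirac, lp.norm_single]

lemma norm_apply_le (f : L2 X) (x : X) : ‖f x‖ ≤ ‖f‖ := lp.norm_apply_le_norm (by norm_num) f x

lemma norm_entry_le (T : L2 X →L[ℂ] L2 X) (x y : X) : ‖entry T x y‖ ≤ ‖T (dirac y)‖ := by
  rw [entry_eq_apply]
  exact norm_apply_le _ _

lemma norm_entry_le_opNorm (T : L2 X →L[ℂ] L2 X) (x y : X) : ‖entry T x y‖ ≤ ‖T‖ :=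
  (norm_entry_le T x y).trans (by simpa using T.le_opNorm (dirac y))

lemma hasSum_dirac (f : L2 X) : HasSum (fun x => f x • (dirac x : L2 X)) f := by
  classical
  have h := lp.hasSum_single (p := 2) (by norm_num) f
  convert h using 2 with x
  rw [dirac, ← lp.single_smul]
  simp only [smul_eq_mul, mul_one]

lemma ext_entry {S T : L2 X →L[ℂ] L2 X} (h : ∀ x y, entry S x y = entry T x y) : S = T := by
  have h1 : ∀ y, S (dirac y) = T (dirac y) := fun y => by
    ext x
    simpa [entry_eq_apply] using h x y
  ext1 f
  have hS := (hasSum_dirac f).mapL S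
  have hT := (hasSum_dirac f).mapL T
  simp only [map_smul, h1] at hS hT
  exact hS.unique hT

@[simp] lemma entry_add (S T : L2 X →L[ℂ] L2 X) (x y : X) :
    entry (S + T) x y = entry S x y + entry T x y := by
  simp [entry]

@[simp] lemma entry_sub (S T : L2 X →L[ℂ] L2 X) (x y : X) :
    entry (S - T) x y = entry S x y - entry T x y := by
  simp [entry]

lemma entry_star (T : L2 X →L[ℂ] L2 X) (x y : X) :
    entry (star T) x y = starRingEnd ℂ (entry T y x) := by
  rw [entry, entry, ContinuousLinearMap.star_eq_adjoint, ContinuousLinearMap.adjoint_inner_right,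
    inner_conj_symm]

lemma isSelfAdjoint_of_entry {T : L2 X →L[ℂ] L2 X}
    (h : ∀ x y, entry T x y = starRingEnd ℂ (entry T y x)) : IsSelfAdjoint T :=
  ext_entry fun x y => by rw [entry_star, ← h]

lemma hasSum_entry_mul (T : L2 X →L[ℂ] L2 X) (f : L2 X) (x : X) :
    HasSum (fun y => f y * entry T x y) (T f x) := by
  have h := ((hasSum_dirac f).mapL T).mapL (innerSL ℂ (dirac x : L2 X))
  simpa [inner_smul_right, inner_dirac_left, entry_eq_apply] using h

lemma norm_sq_eq_tsum (f : L2 X) : ‖f‖ ^ 2 = ∑' x, ‖f x‖ ^ 2 := by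
  have := lp.norm_rpow_eq_tsum (p := 2) (by norm_num) f
  simpa using this

lemma sum_norm_sq_le (f : L2 X) (s : Finset X) : ∑ x ∈ s, ‖f x‖ ^ 2 ≤ ‖f‖ ^ 2 := by
  have := lp.sum_rpow_le_norm_rpow (p := 2) (by norm_num) f s
  simpa using this

lemma norm_le_of_sum_sq_le {f : L2 X} {C : ℝ} (hC : 0 ≤ C)
    (h : ∀ s : Finset X, ∑ x ∈ s, ‖f x‖ ^ 2 ≤ C ^ 2) : ‖f‖ ≤ C :=
  lp.norm_le_of_forall_sum_le (p := 2) (by norm_num) hC (by simpa using h)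

/-- A matrix supported on a symmetric relation with at most `N` neighbours of each point and
entries bounded by `C` is the matrix of an operator of norm at most `C * N`. -/
lemma exists_operator_of_band {a : X → X → ℂ} {nbr : X → Finset X} {N : ℕ} {C : ℝ} (hC : 0 ≤ C)
    (hsymm : ∀ x y, y ∈ nbr x → x ∈ nbr y) (hcard : ∀ x, (nbr x).card ≤ N)
    (hsupp : ∀ x y, y ∉ nbr x → a x y = 0) (hbound : ∀ x y, ‖a x y‖ ≤ C) :
    ∃ T : L2 X →L[ℂ] L2 X, (∀ x y, entry T x y = a x y) ∧ ‖T‖ ≤ C * N := by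
  classical
  have key : ∀ (f : L2 X) (s : Finset X),
      ∑ x ∈ s, ‖∑ y ∈ nbr x, a x y * f y‖ ^ 2 ≤ (C * N * ‖f‖) ^ 2 := by
    intro f s
    have h1 : ∀ x, ‖∑ y ∈ nbr x, a x y * f y‖ ^ 2 ≤ N * C ^ 2 * ∑ y ∈ nbr x, ‖f y‖ ^ 2 := by
      intro x
      calc ‖∑ y ∈ nbr x, a x y * f y‖ ^ 2 ≤ (∑ y ∈ nbr x, C * ‖f y‖) ^ 2 := by
            gcongr
            refine norm_sum_le_of_le _ fun y _ => ?_
            rw [norm_mul]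
            gcongr
            exact hbound x y
        _ ≤ (nbr x).card * ∑ y ∈ nbr x, (C * ‖f y‖) ^ 2 := sq_sum_le_card_mul_sum_sq
        _ ≤ N * ∑ y ∈ nbr x, (C * ‖f y‖) ^ 2 := by
            gcongr
            exact hcard x
        _ = N * C ^ 2 * ∑ y ∈ nbr x, ‖f y‖ ^ 2 := by
            simp_rw [mul_pow, ← Finset.mul_sum]
            ring
    -- The relation is symmetric, so each `y` is counted at most `N` times.
    have h2 : ∑ x ∈ s, ∑ y ∈ nbr x, ‖f y‖ ^ 2 ≤ N * ‖f‖ ^ 2 := by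
      have h3 : ∑ x ∈ s, ∑ y ∈ nbr x, ‖f y‖ ^ 2
          = ∑ y ∈ s.biUnion nbr, ∑ x ∈ s with y ∈ nbr x, ‖f y‖ ^ 2 := by
        refine Finset.sum_comm' fun x y => ?_
        simp only [Finset.mem_filter, Finset.mem_biUnion]
        exact ⟨fun h => ⟨h, x, h⟩, fun h => h.1⟩
      rw [h3]
      calc _ ≤ ∑ y ∈ s.biUnion nbr, (N : ℝ) * ‖f y‖ ^ 2 := by
            refine Finset.sum_le_sum fun y _ => ?_
            rw [Finset.sum_const, nsmul_eq_mul]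
            gcongr
            refine (Finset.card_le_card (t := nbr y) fun x hx => ?_).trans (hcard y)
            exact hsymm _ _ (Finset.mem_filter.1 hx).2
        _ ≤ N * ‖f‖ ^ 2 := by
            rw [← Finset.mul_sum]
            gcongr
            exact sum_norm_sq_le f _
    calc _ ≤ ∑ x ∈ s, N * C ^ 2 * ∑ y ∈ nbr x, ‖f y‖ ^ 2 := Finset.sum_le_sum fun x _ => h1 x
      _ = N * C ^ 2 * ∑ x ∈ s, ∑ y ∈ nbr x, ‖f y‖ ^ 2 := by rw [Finset.mul_sum]
      _ ≤ N * C ^ 2 * (N * ‖f‖ ^ 2) := by gcongr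
      _ = (C * N * ‖f‖) ^ 2 := by ring
  have hmem : ∀ f : L2 X, Memℓp (fun x => ∑ y ∈ nbr x, a x y * f y) 2 := fun f =>
    memℓp_gen' (C := (C * N * ‖f‖) ^ 2) (by simpa using key f)
  let L : L2 X →ₗ[ℂ] L2 X :=
    { toFun := fun f => ⟨fun x => ∑ y ∈ nbr x, a x y * f y, hmem f⟩
      map_add' := fun f g => by
        ext x
        simp only [lp.coeFn_add, Pi.add_apply, mul_add, Finset.sum_add_distrib]
      map_smul' := fun c f => by
        ext x
        simp only [lp.coeFn_smul, Pi.smul_apply, smul_eq_mul, RingHom.id_apply, Finset.mul_sum]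
        exact Finset.sum_congr rfl fun y _ => by ring }
  have hL : ∀ f, ‖L f‖ ≤ C * N * ‖f‖ := fun f =>
    norm_le_of_sum_sq_le (by positivity) (key f)
  refine ⟨L.mkContinuous (C * N) hL, fun x y => ?_, L.mkContinuous_norm_le (by positivity) hL⟩
  rw [entry_eq_apply]
  change ∑ z ∈ nbr x, a x z * (dirac y : L2 X) z = a x y
  simp only [dirac_apply, mul_ite, mul_one, mul_zero, Finset.sum_ite_eq']
  split_ifs with h
  · rfl
  · exact (hsupp x y h).symm

lemma norm_le_of_band {T : L2 X →L[ℂ] L2 X} {nbr : X → Finset X} {N : ℕ} {C : ℝ} (hC : 0 ≤ C)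
    (hsymm : ∀ x y, y ∈ nbr x → x ∈ nbr y) (hcard : ∀ x, (nbr x).card ≤ N)
    (hsupp : ∀ x y, y ∉ nbr x → entry T x y = 0) (hbound : ∀ x y, ‖entry T x y‖ ≤ C) :
    ‖T‖ ≤ C * N := by
  obtain ⟨S, hS, hn⟩ := exists_operator_of_band hC hsymm hcard hsupp hbound
  rwa [← ext_entry hS]

/-- The element of `ℓ²(X)` with prescribed values on a finite set, and `0` elsewhere. -/
def ofFinset (s : Finset X) (u : X → ℂ) : L2 X := ∑ x ∈ s, u x • dirac x

lemma ofFinset_apply [DecidableEq X] (s : Finset X) (u : X → ℂ) (x : X) :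
    ofFinset s u x = if x ∈ s then u x else 0 := by
  rw [ofFinset, lp.coeFn_sum]
  simp [dirac_apply]

lemma norm_ofFinset_sq (s : Finset X) (u : X → ℂ) : ‖ofFinset s u‖ ^ 2 = ∑ x ∈ s, ‖u x‖ ^ 2 := by
  classical
  rw [norm_sq_eq_tsum, tsum_eq_sum (s := s)]
  · exact Finset.sum_congr rfl fun x hx => by simp [ofFinset_apply, hx]
  · intro x hx
    simp [ofFinset_apply, hx]

lemma inner_ofFinset (T : L2 X →L[ℂ] L2 X) (s : Finset X) (u v : X → ℂ) :
    inner ℂ (ofFinset s u) (T (ofFinset s v))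
      = ∑ x ∈ s, ∑ y ∈ s, starRingEnd ℂ (u x) * v y * entry T x y := by
  simp only [ofFinset, sum_inner, inner_smul_left, map_sum, map_smul, inner_sum, inner_smul_right,
    Finset.mul_sum, entry]
  rw [Finset.sum_comm]
  exact Finset.sum_congr rfl fun x _ => Finset.sum_congr rfl fun y _ => by ring

lemma tendsto_ofFinset (f : L2 X) :
    Tendsto (fun s : Finset X => ofFinset s f) atTop (𝓝 f) := hasSum_dirac f

lemma eq_ofFinset {f : L2 X} {s : Finset X} (h : ∀ x ∉ s, f x = 0) : f = ofFinset s f := by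
  classical
  ext x
  rw [ofFinset_apply]
  split_ifs with hx
  · rfl
  · exact h x hx

lemma opNorm_le_of_ofFinset {T : L2 X →L[ℂ] L2 X} {C : ℝ} (hC : 0 ≤ C)
    (h : ∀ (s : Finset X) (u v : X → ℂ),
      ‖inner ℂ (ofFinset s u) (T (ofFinset s v))‖ ≤ C * ‖ofFinset s u‖ * ‖ofFinset s v‖) :
    ‖T‖ ≤ C := by
  have h1 : ∀ f g : L2 X, ‖inner ℂ f (T g)‖ ≤ C * ‖f‖ * ‖g‖ := by
    intro f g
    have hf := tendsto_ofFinset f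
    have hg := tendsto_ofFinset g
    exact le_of_tendsto_of_tendsto' (hf.inner ((T.continuous.tendsto g).comp hg)).norm
      ((hf.norm.const_mul C).mul hg.norm) fun s => h s f g
  refine T.opNorm_le_bound hC fun g => ?_
  have h2 := h1 (T g) g
  rw [inner_self_eq_norm_sq_to_K] at h2
  have h3 : ‖T g‖ * ‖T g‖ ≤ ‖T g‖ * (C * ‖g‖) := by
    simp only [norm_pow, RCLike.norm_ofReal, abs_norm] at h2
    nlinarith
  rcases (norm_nonneg (T g)).eq_or_lt' with h0 | h0
  · rw [h0]
    positivity
  · exact le_of_mul_le_mul_left h3 h0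

end Entries

/-! ### Positive definite kernels and Schur multipliers -/

section Kernels

variable {X : Type*}

lemma posSemidef_real_iff {k : Matrix X X ℝ} :
    k.PosSemidef ↔ (∀ x y, k x y = k y x) ∧
      ∀ (s : Finset X) (v : X → ℝ), 0 ≤ ∑ x ∈ s, ∑ y ∈ s, v x * k x y * v y := by
  classical
  constructor
  · rintro ⟨h1, h2⟩
    refine ⟨fun x y => by simpa using h1.apply y x, fun s v => ?_⟩
    let f : X →₀ ℝ := Finsupp.indicator s fun x _ => v x
    have hf : ∀ x ∈ s, f x = v x := fun x hx => by simp [f, hx]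
    have hsub : f.support ⊆ s := Finsupp.support_indicator_subset _ _
    have hsum : ∀ g : X → ℝ → ℝ, (∀ x, g x 0 = 0) → f.sum g = ∑ x ∈ s, g x (v x) := by
      intro g hg
      rw [Finsupp.sum_of_support_subset f hsub g fun x _ => hg x]
      exact Finset.sum_congr rfl fun x hx => by rw [hf x hx]
    have h := h2 f
    rw [hsum _ fun x => by simp] at h
    simp_rw [hsum _ fun y => mul_zero _] at h
    simpa using h
  · rintro ⟨h1, h2⟩
    exact ⟨Matrix.IsHermitian.ext fun x y => by simpa using h1 y x,
      fun f => by simpa [Finsupp.sum] using h2 f.support f⟩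

lemma abs_apply_le_one_of_posSemidef {k : Matrix X X ℝ} (hk : k.PosSemidef)
    (h1 : ∀ x, k x x ≤ 1) (x y : X) : |k x y| ≤ 1 := by
  classical
  obtain ⟨hs, hp⟩ := posSemidef_real_iff.1 hk
  by_cases hxy : x = y
  · subst hxy
    exact abs_le.2 ⟨by linarith [hk.diag_nonneg (i := x)], h1 x⟩
  -- The test vectors `(1, 1)` and `(1, -1)` give `∓2 k x y ≤ k x x + k y y`.
  have h2 := hp {x, y} fun _ => 1
  have h3 := hp {x, y} fun z => if z = x then 1 else -1
  simp only [Finset.sum_pair hxy, if_neg (Ne.symm hxy), if_true] at h2 h3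
  rw [abs_le]
  constructor <;> linarith [h1 x, h1 y, hs x y]

/-- The quadratic form is a sum of squares, one for each fibre of `f`. -/
lemma posSemidef_of_fibers {β : Type*} [DecidableEq β] (f : X → β) (g : X → ℝ) :
    Matrix.PosSemidef (fun x y => if f x = f y then g x * g y else 0 : Matrix X X ℝ) := by
  refine posSemidef_real_iff.2 ⟨fun x y => ?_, fun s v => ?_⟩
  · by_cases h : f x = f y
    · simp [h, mul_comm]
    · simp [h, Ne.symm h]
  · have : ∑ x ∈ s, ∑ y ∈ s, v x * (if f x = f y then g x * g y else 0) * v y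
        = ∑ c ∈ s.image f, (∑ x ∈ s, if f x = c then v x * g x else 0) ^ 2 := by
      simp_rw [sq, Finset.sum_mul_sum]
      symm
      rw [Finset.sum_comm]
      refine Finset.sum_congr rfl fun x hx => ?_
      rw [Finset.sum_comm]
      refine Finset.sum_congr rfl fun y hy => ?_
      rw [Finset.sum_eq_single_of_mem (f x) (Finset.mem_image_of_mem f hx)]
      · by_cases h : f x = f y
        · simp [h]
          ring
        · simp [h, Ne.symm h]
      · intro c _ hc
        simp [Ne.symm hc]
    rw [this]
    positivity

lemma posSemidef_mul_mul {k : Matrix X X ℝ} (hk : k.PosSemidef) (g : X → ℝ) :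
    Matrix.PosSemidef (fun x y => g x * k x y * g y : Matrix X X ℝ) := by
  obtain ⟨h1, h2⟩ := posSemidef_real_iff.1 hk
  refine posSemidef_real_iff.2 ⟨fun x y => ?_, fun s v => ?_⟩
  · rw [h1 x y]
    ring
  · refine (h2 s fun x => v x * g x).trans_eq
      (Finset.sum_congr rfl fun x _ => Finset.sum_congr rfl fun y _ => ?_)
    ring

open scoped MatrixOrder in
lemma exists_gram {k : Matrix X X ℝ} (hk : k.PosSemidef) (s : Finset X) :
    ∃ b : X → X → ℝ, ∀ x ∈ s, ∀ y ∈ s, k x y = ∑ i ∈ s, b i x * b i y := by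
  classical
  obtain ⟨B, hB⟩ := CStarAlgebra.nonneg_iff_eq_star_mul_self.mp
    (hk.submatrix ((↑) : s → X)).nonneg
  refine ⟨fun i x => if h : i ∈ s ∧ x ∈ s then B ⟨i, h.1⟩ ⟨x, h.2⟩ else 0, fun x hx y hy => ?_⟩
  have h := congr_fun (congr_fun hB ⟨x, hx⟩) ⟨y, hy⟩
  rw [Matrix.submatrix_apply] at h
  rw [h, Matrix.mul_apply, ← Finset.sum_coe_sort s]
  exact Finset.sum_congr rfl fun i _ => by simp [hx, hy]

/-- The Schur multiplier of a positive definite kernel with diagonal at most `1` is contractive. -/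
lemma norm_le_of_entry_eq_mul {k : Matrix X X ℝ} (hk : k.PosSemidef) (h1 : ∀ x, k x x ≤ 1)
    {S T : L2 X →L[ℂ] L2 X} (h : ∀ x y, entry S x y = k x y * entry T x y) : ‖S‖ ≤ ‖T‖ := by
  refine opNorm_le_of_ofFinset (norm_nonneg _) fun s u v => ?_
  obtain ⟨b, hb⟩ := exists_gram hk s
  -- A Gram decomposition of `k` splits the form of `S` into forms of `T` at `b i * u` and `b i *
  -- v`. The diagonal bound gives `∑ ‖b i * u‖² ≤ ‖u‖²`, and Cauchy-Schwarz over `i` concludes.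
  have hsum : inner ℂ (ofFinset s u) (S (ofFinset s v))
      = ∑ i ∈ s, inner ℂ (ofFinset s fun x => b i x * u x) (T (ofFinset s fun x => b i x * v x)) := by
    simp only [inner_ofFinset]
    symm
    rw [Finset.sum_comm]
    refine Finset.sum_congr rfl fun x hx => ?_
    rw [Finset.sum_comm]
    refine Finset.sum_congr rfl fun y hy => ?_
    rw [h, hb x hx y hy, Complex.ofReal_sum, Finset.sum_mul, Finset.mul_sum]
    refine Finset.sum_congr rfl fun i _ => ?_
    simp only [map_mul, Complex.conj_ofReal, Complex.ofReal_mul]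
    ring
  have hnorm : ∀ w : X → ℂ,
      √(∑ i ∈ s, ‖ofFinset s fun x => b i x * w x‖ ^ 2) ≤ ‖ofFinset s w‖ := by
    intro w
    refine Real.sqrt_le_iff.2 ⟨norm_nonneg _, ?_⟩
    simp only [norm_ofFinset_sq]
    rw [Finset.sum_comm]
    refine Finset.sum_le_sum fun x hx => ?_
    have h2 : ∑ i ∈ s, b i x * b i x ≤ 1 := (hb x hx x hx).symm.trans_le (h1 x)
    calc ∑ i ∈ s, ‖(b i x : ℂ) * w x‖ ^ 2 = (∑ i ∈ s, b i x * b i x) * ‖w x‖ ^ 2 := by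
          rw [Finset.sum_mul]
          refine Finset.sum_congr rfl fun i _ => ?_
          rw [norm_mul, mul_pow, Complex.norm_real, Real.norm_eq_abs, sq_abs, sq (b i x)]
      _ ≤ ‖w x‖ ^ 2 := mul_le_of_le_one_left (by positivity) h2
  rw [hsum]
  calc _ ≤ ∑ i ∈ s, ‖T‖ * (‖ofFinset s fun x => b i x * u x‖ * ‖ofFinset s fun x => b i x * v x‖) := by
        refine norm_sum_le_of_le _ fun i _ => ?_
        refine (norm_inner_le_norm _ _).trans ?_
        rw [mul_left_comm]
        gcongr
        exact T.le_opNorm _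
    _ ≤ ‖T‖ * (√(∑ i ∈ s, ‖ofFinset s fun x => b i x * u x‖ ^ 2)
          * √(∑ i ∈ s, ‖ofFinset s fun x => b i x * v x‖ ^ 2)) := by
        rw [← Finset.mul_sum]
        gcongr
        exact Real.sum_mul_le_sqrt_mul_sqrt _ _ _
    _ ≤ ‖T‖ * (‖ofFinset s u‖ * ‖ofFinset s v‖) := by
        gcongr
        exacts [hnorm u, hnorm v]
    _ = _ := by ring

end Kernels

/-! ### Operators of finite propagation -/

section Propagation

variable {X : Type*}

/-- The coordinate projection onto the functions supported on a finite set. -/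
def coordProj (s : Finset X) : L2 X →L[ℂ] L2 X :=
  ∑ x ∈ s, (innerSL ℂ (dirac x : L2 X)).smulRight (dirac x)

lemma coordProj_apply (s : Finset X) (f : L2 X) : coordProj s f = ofFinset s f := by
  simp [coordProj, ofFinset, inner_dirac_left]

lemma isCompactOperator_coordProj (s : Finset X) : IsCompactOperator (coordProj s) := by
  rw [coordProj]
  refine Finset.sum_induction _ (fun T : L2 X →L[ℂ] L2 X => IsCompactOperator T)
    (fun S T hS hT => hS.add hT) isCompactOperator_zero fun x _ => ?_
  have h : IsCompactOperator (ContinuousLinearMap.toSpanSingleton ℂ (dirac x : L2 X)) :=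
    isCompactOperator_of_locallyCompactSpace_rng _
  exact h.comp_clm (innerSL ℂ (dirac x : L2 X))

lemma entry_coordProj_mul [DecidableEq X] (s : Finset X) (T : L2 X →L[ℂ] L2 X) (x y : X) :
    entry (coordProj s * T) x y = if x ∈ s then entry T x y else 0 := by
  simp [entry_eq_apply, coordProj_apply, ofFinset_apply]

lemma entry_mul_coordProj [DecidableEq X] (s : Finset X) (T : L2 X →L[ℂ] L2 X) (x y : X) :
    entry (T * coordProj s) x y = if y ∈ s then entry T x y else 0 := by
  have h : coordProj s (dirac y : L2 X) = if y ∈ s then dirac y else 0 := by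
    ext x
    rw [coordProj_apply, ofFinset_apply]
    split_ifs with hx hy hy
    · rfl
    · have : x ≠ y := fun h => hy (h ▸ hx)
      simp [dirac_apply, this]
    · have : x ≠ y := fun h => hx (h ▸ hy)
      simp [dirac_apply, this]
    · rfl
  rw [entry_eq_apply, entry_eq_apply, mul_apply_eq_comp, h]
  split_ifs <;> simp

variable [EMetricSpace X]

lemma mem_propagationLE_iff {T : L2 X →L[ℂ] L2 X} {R : ℝ≥0} :
    T ∈ propagationLE X R ↔ ∀ x y, (R : ℝ≥0∞) < edist x y → entry T x y = 0 := by
  simp only [propagationLE, propagation, Set.mem_ofPred_eq, sSup_le_iff]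
  constructor
  · intro h x y hxy
    by_contra hne
    exact absurd (h _ ⟨x, y, hne, rfl⟩) (not_le.2 hxy)
  · rintro h _ ⟨x, y, hne, rfl⟩
    by_contra hlt
    exact hne (h x y (not_le.1 hlt))

lemma BoundedGeometry.exists_neighbors (hX : BoundedGeometry X) (R : ℝ≥0) :
    ∃ (N : ℕ) (nbr : X → Finset X), (∀ x y, y ∈ nbr x ↔ edist y x ≤ R) ∧
      ∀ x, (nbr x).card ≤ N := by
  obtain ⟨N, hN⟩ := hX (R + 1) (by positivity)
  have hsub : ∀ x : X, {y : X | edist y x ≤ R} ⊆ {y : X | edist y x < ((R + 1 : ℝ≥0) : ℝ≥0∞)} :=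
    fun x y hy => lt_of_le_of_lt (b := (R : ℝ≥0∞)) hy (by exact_mod_cast lt_add_one R)
  have hcard : ∀ x : X, {y : X | edist y x ≤ R}.encard ≤ N := fun x =>
    (Set.encard_le_encard (hsub x)).trans (hN x)
  have hfin : ∀ x : X, {y : X | edist y x ≤ R}.Finite := fun x =>
    Set.finite_of_encard_le_coe (hcard x)
  refine ⟨N, fun x => (hfin x).toFinset, fun x y => by simp, fun x => ?_⟩
  have := hcard x
  rw [(hfin x).encard_eq_coe_toFinset_card] at this
  exact_mod_cast this

lemma BoundedGeometry.exists_norm_le (hX : BoundedGeometry X) (R : ℝ≥0) :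
    ∃ N : ℕ, ∀ (T : L2 X →L[ℂ] L2 X) (C : ℝ), 0 ≤ C → T ∈ propagationLE X R →
      (∀ x y, ‖entry T x y‖ ≤ C) → ‖T‖ ≤ C * N := by
  obtain ⟨N, nbr, hnbr, hN⟩ := hX.exists_neighbors R
  refine ⟨N, fun T C hC hT h => norm_le_of_band hC (fun x y h => ?_) hN (fun x y h => ?_) h⟩
  · rw [hnbr] at h ⊢
    rwa [edist_comm]
  · rw [hnbr, not_le] at h
    exact mem_propagationLE_iff.1 hT x y (by rwa [edist_comm])

lemma BoundedGeometry.exists_operator (hX : BoundedGeometry X) {a : X → X → ℂ} {R : ℝ≥0} {C : ℝ}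
    (ha : ∀ x y, (R : ℝ≥0∞) < edist x y → a x y = 0) (hC : ∀ x y, ‖a x y‖ ≤ C) :
    ∃ T : L2 X →L[ℂ] L2 X, T ∈ propagationLE X R ∧ ∀ x y, entry T x y = a x y := by
  obtain ⟨N, nbr, hnbr, hN⟩ := hX.exists_neighbors R
  have hsymm : ∀ x y, y ∈ nbr x → x ∈ nbr y := fun x y h => by
    rw [hnbr] at h ⊢
    rwa [edist_comm]
  have hsupp : ∀ x y, y ∉ nbr x → a x y = 0 := fun x y h => by
    rw [hnbr, not_le] at h
    exact ha x y (by rwa [edist_comm])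
  obtain ⟨T, hT, -⟩ := exists_operator_of_band (C := max C 0) (le_max_right _ _) hsymm hN hsupp
    fun x y => (hC x y).trans (le_max_left _ _)
  exact ⟨T, mem_propagationLE_iff.2 fun x y h => (hT x y).trans (ha x y h), hT⟩

/-- On a space of bounded geometry, a ghost of finite propagation is compact. -/
lemma BoundedGeometry.isCompactOperator_of_propagationLE (hX : BoundedGeometry X)
    {T : L2 X →L[ℂ] L2 X} {R : ℝ≥0} (hT : T ∈ propagationLE X R)
    (h0 : Tendsto (fun p : X × X => entry T p.1 p.2) (cofinite ×ˢ cofinite) (𝓝 0)) :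
    IsCompactOperator T := by
  classical
  obtain ⟨N, hN⟩ := hX.exists_norm_le R
  refine isClosed_setOfPred_isCompactOperator.closure_subset (s := {f : L2 X →L[ℂ] L2 X | IsCompactOperator f})
    (Metric.mem_closure_iff.2 fun ε hε => ?_)
  set δ : ℝ := ε / (N + 1) with hδ
  have hδ0 : 0 < δ := by positivity
  have hev : ∀ᶠ p : X × X in cofinite ×ˢ cofinite, ‖entry T p.1 p.2‖ < δ := by
    simpa using h0.eventually (Metric.ball_mem_nhds 0 hδ0)
  obtain ⟨p, hp, q, hq, hpq⟩ := eventually_prod_iff.1 hev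
  set s : Finset X := (mem_cofinite.1 hp).toFinset ∪ (mem_cofinite.1 hq).toFinset with hs
  have hsmall : ∀ x ∉ s, ∀ y ∉ s, ‖entry T x y‖ < δ := by
    intro x hx y hy
    simp only [hs, Finset.mem_union, Set.Finite.mem_toFinset, Set.mem_compl_iff, not_or,
      not_not] at hx hy
    exact hpq hx.1 hy.2
  -- With `P` the projection onto `s`, the error is `(1 - P) T (1 - P)`, whose entries are all below
  -- `δ`.
  refine ⟨coordProj s * T + (T * coordProj s - coordProj s * (T * coordProj s)), ?_, ?_⟩
  · have hP := isCompactOperator_coordProj s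
    exact (hP.comp_clm T).add ((hP.clm_comp T).sub (hP.comp_clm (T * coordProj s)))
  · rw [dist_eq_norm]
    have hent : ∀ x y, entry (T - (coordProj s * T
        + (T * coordProj s - coordProj s * (T * coordProj s)))) x y
        = if x ∈ s ∨ y ∈ s then 0 else entry T x y := by
      intro x y
      simp only [entry_sub, entry_add, entry_coordProj_mul, entry_mul_coordProj]
      by_cases hx : x ∈ s <;> by_cases hy : y ∈ s <;> simp [hx, hy]
    refine (hN _ δ hδ0.le (mem_propagationLE_iff.2 fun x y hxy => ?_) fun x y => ?_).trans_lt ?_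
    · rw [hent, mem_propagationLE_iff.1 hT x y hxy, ite_self]
    · rw [hent]
      split_ifs with h
      · simpa using hδ0.le
      · rw [not_or] at h
        exact (hsmall x h.1 y h.2).le
    · rw [hδ, div_mul_eq_mul_div, div_lt_iff₀ (by positivity)]
      nlinarith

/-- On a space of bounded geometry with property A, all ghosts are compact. -/
lemma BoundedGeometry.isCompactOperator_of_isGhost (hX : BoundedGeometry X) (hA : PropertyA X)
    {T : L2 X →L[ℂ] L2 X} (hT : IsGhost T) : IsCompactOperator T := by
  obtain ⟨k, hk, hprop, hone⟩ := hA
  refine isClosed_setOfPred_isCompactOperator.closure_subset (s := {f : L2 X →L[ℂ] L2 X | IsCompactOperator f})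
    (Metric.mem_closure_iff.2 fun ε hε => ?_)
  obtain ⟨S, hS, hTS⟩ := Metric.mem_closure_iff.1 hT.1 (ε / 3) (by positivity)
  obtain ⟨R, hR⟩ := Set.mem_iUnion.1 hS
  rw [dist_eq_norm] at hTS
  obtain ⟨N, hN⟩ := hX.exists_norm_le R
  set δ : ℝ := ε / 3 / ((‖S‖ + 1) * (N + 1)) with hδ
  have hδ0 : 0 < δ := by positivity
  -- Property A controls distances strictly below the scale; `R + 1` covers the closed band of `S`.
  obtain ⟨n, hn⟩ := hone (R + 1) (by positivity) δ hδ0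
  specialize hn (n + 1) (Nat.lt_succ_self n)
  have hkk := hk (n + 1)
  obtain ⟨r, hr⟩ := hprop (n + 1)
  set κ := k (n + 1)
  have hdiag : ∀ x, κ x x ≤ 1 := fun x => (hn x x (by simp)).2
  have hκ := abs_apply_le_one_of_posSemidef hkk hdiag
  have hmult : ∀ Q : L2 X →L[ℂ] L2 X, ∃ M : L2 X →L[ℂ] L2 X,
      M ∈ propagationLE X r ∧ ∀ x y, entry M x y = κ x y * entry Q x y := by
    intro Q
    refine hX.exists_operator (C := ‖Q‖) (fun x y hxy => by simp [hr x y hxy]) fun x y => ?_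
    rw [norm_mul, Complex.norm_real, Real.norm_eq_abs]
    exact (mul_le_of_le_one_left (norm_nonneg _) (hκ x y)).trans (norm_entry_le_opNorm Q x y)
  obtain ⟨M, hMr, hM⟩ := hmult T
  obtain ⟨M', -, hM'⟩ := hmult S
  refine ⟨M, hX.isCompactOperator_of_propagationLE hMr ?_, ?_⟩
  · refine squeeze_zero_norm (fun p => ?_) (tendsto_zero_iff_norm_tendsto_zero.1 hT.2)
    rw [hM, norm_mul, Complex.norm_real, Real.norm_eq_abs]
    exact mul_le_of_le_one_left (norm_nonneg _) (hκ _ _)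
  · have h1 : ‖M' - M‖ ≤ ‖T - S‖ := by
      rw [norm_sub_rev T S]
      exact norm_le_of_entry_eq_mul hkk hdiag fun x y => by
        rw [entry_sub, entry_sub, hM, hM']
        ring
    have h2 : ‖S - M'‖ ≤ δ * ‖S‖ * N := by
      refine hN _ _ (by positivity) (mem_propagationLE_iff.2 fun x y hxy => ?_) fun x y => ?_
      · rw [entry_sub, hM', mem_propagationLE_iff.1 hR x y hxy]
        simp
      · rw [entry_sub, hM']
        by_cases hxy : (R : ℝ≥0∞) < edist x y
        · rw [mem_propagationLE_iff.1 hR x y hxy]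
          simp only [mul_zero, sub_zero, norm_zero]
          positivity
        · have h3 := hn x y ((not_lt.1 hxy).trans_lt (by exact_mod_cast lt_add_one R))
          rw [← one_sub_mul, norm_mul, ← Complex.ofReal_one, ← Complex.ofReal_sub,
            Complex.norm_real, Real.norm_eq_abs, abs_of_nonneg (by linarith)]
          gcongr
          · linarith
          · exact norm_entry_le_opNorm S x y
    have h3 : δ * ‖S‖ * N ≤ ε / 3 := by
      rw [hδ, mul_assoc, div_mul_eq_mul_div, div_le_iff₀ (by positivity)]
      have : 0 ≤ ‖S‖ := norm_nonneg _
      gcongr <;> linarith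
    rw [dist_eq_norm]
    calc ‖T - M‖ = ‖(T - S) + (S - M') + (M' - M)‖ := by congr 1; abel
      _ ≤ ‖T - S‖ + ‖S - M'‖ + ‖M' - M‖ := norm_add₃_le
      _ < ε := by linarith

end Propagation

/-! ### Localized kernels and the negation of property A -/

section LocalKernels

variable {X : Type*} [EMetricSpace X]

/-- There is a positive definite kernel, with diagonal at most `1` and vanishing at distances
greater than `S`, which is at least `1 - ε` on the pairs of points of `Y` at distance at most
`r`. -/
def HasLocalKernel (Y : Set X) (r S : ℝ≥0) (ε : ℝ) : Prop :=
  ∃ k : Matrix X X ℝ, k.PosSemidef ∧ (∀ x, k x x ≤ 1) ∧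
    (∀ x y, (S : ℝ≥0∞) < edist x y → k x y = 0) ∧
    ∀ x ∈ Y, ∀ y ∈ Y, edist x y ≤ r → 1 - ε ≤ k x y

/-- Taking scale `n` and closeness `1/(n + 1)` gives the sequence; the upper bound 1 is automatic
from positivity and the diagonal. -/
lemma propertyA_of_hasLocalKernel
    (h : ∀ (r : ℝ≥0) (ε : ℝ), 0 < ε → ∃ S, HasLocalKernel (Set.univ : Set X) r S ε) :
    PropertyA X := by
  have h' : ∀ n : ℕ, ∃ S, HasLocalKernel (Set.univ : Set X) n S (1 / ((n : ℝ) + 1)) :=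
    fun n => h n _ (by positivity)
  choose S k hk hdiag hprop hclose using h'
  refine ⟨k, hk, fun n => ⟨S n, hprop n⟩, fun s _ ε hε => ?_⟩
  obtain ⟨N₁, hN₁⟩ := exists_nat_gt s
  obtain ⟨N₂, hN₂⟩ := exists_nat_one_div_lt hε
  refine ⟨max N₁ N₂, fun n hn x y hxy => ⟨?_, ?_⟩⟩
  · have h1 : edist x y ≤ ((n : ℝ≥0) : ℝ≥0∞) := by
      refine hxy.le.trans ?_
      have : (N₁ : ℝ≥0) ≤ n := by exact_mod_cast ((le_max_left _ _).trans hn.le)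
      exact_mod_cast hN₁.le.trans this
    refine le_trans ?_ (hclose n x (Set.mem_univ _) y (Set.mem_univ _) h1)
    have h2 : 1 / ((n : ℝ) + 1) ≤ 1 / ((N₂ : ℝ) + 1) :=
      one_div_le_one_div_of_le (by positivity)
        (by have : (N₂ : ℝ) ≤ n := by exact_mod_cast ((le_max_right _ _).trans hn.le)
            linarith)
    linarith
  · exact (abs_le.1 (abs_apply_le_one_of_posSemidef (hk n) (hdiag n) x y)).2

/-- Entries lie in `[-1, 1]`, so the kernels on finite subsets have a pointwise limit along an
ultrafilter, and every condition involves finitely many entries. -/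
lemma hasLocalKernel_of_forall_finset {Y : Set X} {r S : ℝ≥0} {ε : ℝ}
    (h : ∀ F : Finset X, (F : Set X) ⊆ Y → HasLocalKernel (F : Set X) r S ε) :
    HasLocalKernel Y r S ε := by
  classical
  have h' : ∀ F : Finset X, HasLocalKernel ((F.filter (· ∈ Y) : Finset X) : Set X) r S ε :=
    fun F => h _ fun x hx => (Finset.mem_filter.1 hx).2
  choose k hk hdiag hprop hclose using h'
  let U : Ultrafilter (Finset X) := Ultrafilter.of atTop
  have hU : (U : Filter (Finset X)) ≤ atTop := Ultrafilter.of_le _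
  have hlim : ∀ x y, ∃ l, Tendsto (fun F => k F x y) U (𝓝 l) := by
    intro x y
    obtain ⟨l, -, hl⟩ := (isCompact_Icc (a := (-1 : ℝ)) (b := 1)).ultrafilter_le_nhds
      (U.map fun F => k F x y)
      (le_principal_iff.2 (Eventually.of_forall (f := (U : Filter (Finset X))) fun F =>
        abs_le.1 (abs_apply_le_one_of_posSemidef (hk F) (hdiag F) x y)))
    exact ⟨l, hl⟩
  choose κ hκ using hlim
  refine ⟨κ, posSemidef_real_iff.2 ⟨fun x y => ?_, fun s v => ?_⟩, fun x => ?_, fun x y hxy => ?_,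
    fun x hx y hy hxy => ?_⟩
  · refine tendsto_nhds_unique (hκ x y) ((hκ y x).congr fun F => ?_)
    exact (posSemidef_real_iff.1 (hk F)).1 y x
  · refine ge_of_tendsto' (f := fun F => ∑ x ∈ s, ∑ y ∈ s, v x * k F x y * v y)
      (x := (U : Filter (Finset X))) ?_ fun F => (posSemidef_real_iff.1 (hk F)).2 s v
    exact tendsto_finsetSum _ fun x _ => tendsto_finsetSum _ fun y _ =>
      ((hκ x y).const_mul _).mul_const _
  · exact le_of_tendsto' (hκ x x) fun F => hdiag F x
  · exact tendsto_nhds_unique (hκ x y) (tendsto_const_nhds.congr fun F => (hprop F x y hxy).symm)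
  · refine ge_of_tendsto (hκ x y) ?_
    filter_upwards [hU (eventually_ge_atTop {x, y})] with F hF
    have hxF : x ∈ F := hF (by simp)
    have hyF : y ∈ F := hF (by simp)
    exact hclose F x (by simp [hx, hxF]) y (by simp [hy, hyF]) hxy

/-- A localized kernel on the complement of a finite set can be extended over the finite set, at
the cost of some closeness and locality. -/
lemma HasLocalKernel.univ_of_compl (hX : BoundedGeometry X) {G : Finset X} {r S : ℝ≥0} {ε : ℝ}
    (hε : 0 < ε) (hε1 : ε ≤ 1) (h : HasLocalKernel ((G : Set X)ᶜ) r S ε) :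
    ∃ S', HasLocalKernel (Set.univ : Set X) r S' (2 * ε) := by
  classical
  obtain ⟨k, hk, hdiag, hprop, hclose⟩ := h
  obtain ⟨L, hL⟩ := exists_nat_one_div_lt hε
  let nb : ℕ → Set X := fun j => {x | ∃ g ∈ G, edist x g ≤ j * (r : ℝ≥0∞)}
  have hmono : ∀ i j, i ≤ j → nb i ⊆ nb j := by
    rintro i j hij x ⟨g, hg, hx⟩
    exact ⟨g, hg, hx.trans (by gcongr)⟩
  have hstep : ∀ i x y, x ∈ nb i → edist x y ≤ r → y ∈ nb (i + 1) := by
    rintro i x y ⟨g, hg, hx⟩ hxy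
    refine ⟨g, hg, (edist_triangle y x g).trans ?_⟩
    rw [edist_comm, Nat.cast_add, Nat.cast_one, add_mul, one_mul, add_comm]
    exact add_le_add hx hxy
  have hG : ∀ i, ∀ x ∉ nb i, x ∈ (G : Set X)ᶜ := fun i x hx hxG =>
    hx ⟨x, hxG, by simp⟩
  have hfin : ∀ i, (nb i).Finite := by
    intro i
    obtain ⟨N, nbr, hnbr, -⟩ := hX.exists_neighbors (i * r)
    refine (G.biUnion nbr).finite_toSet.subset ?_
    rintro x ⟨g, hg, hx⟩
    simp only [Finset.coe_biUnion, Set.mem_iUnion]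
    refine ⟨g, hg, (hnbr g x).2 ?_⟩
    push_cast
    exact hx
  -- Distances may be infinite, so the constant kernel on a finite set must be cut along the classes
  -- of finite distance to be local.
  let comp : X → Set X := fun x => {z | edist x z < ⊤}
  have hcomp : ∀ x y, comp x = comp y ↔ edist x y < ⊤ := by
    intro x y
    constructor
    · intro h
      have : y ∈ comp y := by simp [comp]
      rw [← h] at this
      exact this
    · intro h
      ext z
      constructor
      · intro hz
        exact (edist_triangle y x z).trans_lt (ENNReal.add_lt_top.2 ⟨by rwa [edist_comm], hz⟩)
      · intro hz
        exact (edist_triangle x y z).trans_lt (ENNReal.add_lt_top.2 ⟨h, hz⟩)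
  -- Outside `nb j` keep `k`, inside use the constant kernel 1 on each class. This fails only for
  -- pairs that `nb j` separates, and averaging over `j` makes the failure negligible.
  let term : ℕ → Matrix X X ℝ := fun j =>
    (fun x y => (nb j)ᶜ.indicator 1 x * k x y * (nb j)ᶜ.indicator 1 y : Matrix X X ℝ) +
    (fun x y => if comp x = comp y then (nb j).indicator 1 x * (nb j).indicator 1 y else 0 :
      Matrix X X ℝ)
  have hterm : ∀ j x y, term j x y
      = (nb j)ᶜ.indicator 1 x * k x y * (nb j)ᶜ.indicator 1 y
        + if comp x = comp y then (nb j).indicator 1 x * (nb j).indicator 1 y else 0 :=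
    fun j x y => rfl
  have hpsd : ∀ j, (term j).PosSemidef := fun j =>
    (posSemidef_mul_mul hk _).add (posSemidef_of_fibers comp _)
  let D : Finset X := (hfin (L + 1)).toFinset
  let S' : ℝ≥0 := max S ((D ×ˢ D).sup fun p => (edist p.1 p.2).toNNReal)
  have hL0 : (0 : ℝ) < L + 1 := by positivity
  let κ : Matrix X X ℝ := ((L : ℝ) + 1)⁻¹ • ∑ j ∈ Finset.range (L + 1), term j
  have hκ : ∀ x y, κ x y = ((L : ℝ) + 1)⁻¹ * ∑ j ∈ Finset.range (L + 1), term j x y := by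
    intro x y
    simp [κ, Matrix.smul_apply, Matrix.sum_apply]
  refine ⟨S', κ, ?_, fun x => ?_, fun x y hxy => ?_, fun x _ y _ hxy => ?_⟩
  · exact (Matrix.posSemidef_sum _ fun j _ => hpsd j).smul (by positivity)
  · rw [hκ, inv_mul_le_iff₀ hL0, mul_one]
    calc ∑ j ∈ Finset.range (L + 1), term j x x ≤ ∑ j ∈ Finset.range (L + 1), (1 : ℝ) := by
          refine Finset.sum_le_sum fun j _ => ?_
          rw [hterm]
          by_cases hx : x ∈ nb j
          · simp [hx]
          · simpa [hx] using hdiag x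
      _ = L + 1 := by simp
  · rw [hκ]
    refine mul_eq_zero_of_right _ (Finset.sum_eq_zero fun j hj => ?_)
    rw [hterm, hprop x y (lt_of_le_of_lt (by exact_mod_cast le_max_left _ _) hxy)]
    simp only [mul_zero, zero_mul, zero_add, ite_eq_right_iff, hcomp]
    intro htop
    have hj' : j ≤ L + 1 := (Finset.mem_range.1 hj).le
    by_cases hx : x ∈ nb j
    · by_cases hy : y ∈ nb j
      · exfalso
        have h1 : (edist x y).toNNReal ≤ S' := by
          refine le_trans ?_ (le_max_right _ _)
          exact Finset.le_sup (f := fun p : X × X => (edist p.1 p.2).toNNReal)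
            (b := (x, y)) (Finset.mem_product.2
              ⟨(hfin (L + 1)).mem_toFinset.2 (hmono _ _ hj' hx),
                (hfin (L + 1)).mem_toFinset.2 (hmono _ _ hj' hy)⟩)
        have h2 : edist x y ≤ S' := by
          rw [← ENNReal.coe_toNNReal htop.ne]
          exact_mod_cast h1
        exact absurd hxy (not_lt.2 h2)
      · simp [hy]
    · simp [hx]
  · have htop : edist x y < ⊤ := hxy.trans_lt ENNReal.coe_lt_top
    -- A pair at distance at most `r` is separated by at most one of the nested neighbourhoods,
    -- since they grow in steps of `r`. The average therefore loses at most `1/(L + 1) < ε`.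
    let A : Finset ℕ := (Finset.range (L + 1)).filter fun j => ¬ (x ∈ nb j ↔ y ∈ nb j)
    have hsep : ∀ i ∈ A, ∀ j ∈ A, ¬ i < j := by
      intro i hi j hj hij
      have hi := (Finset.mem_filter.1 hi).2
      refine (Finset.mem_filter.1 hj).2 ?_
      have hboth : x ∈ nb (i + 1) ∧ y ∈ nb (i + 1) := by
        by_cases hx : x ∈ nb i
        · exact ⟨hmono _ _ (Nat.le_succ _) hx, hstep i x y hx hxy⟩
        · have hy : y ∈ nb i := by tauto
          exact ⟨hstep i y x hy (by rwa [edist_comm]), hmono _ _ (Nat.le_succ _) hy⟩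
      exact ⟨fun _ => hmono _ _ hij hboth.2, fun _ => hmono _ _ hij hboth.1⟩
    have hA : A.card ≤ 1 := Finset.card_le_one.2 fun i hi j hj =>
      le_antisymm (not_lt.1 (hsep j hj i hi)) (not_lt.1 (hsep i hi j hj))
    have hlow : ∀ j ∈ Finset.range (L + 1),
        (1 - ε) - (if j ∈ A then (1 - ε) else 0) ≤ term j x y := by
      intro j hj
      have hmem : j ∈ A ↔ ¬ (x ∈ nb j ↔ y ∈ nb j) := by
        simp only [A, Finset.mem_filter, hj, true_and]
      rw [hterm, if_pos ((hcomp x y).2 htop)]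
      by_cases hx : x ∈ nb j <;> by_cases hy : y ∈ nb j
      · simp [hmem, hx, hy, hε.le]
      · simp [hmem, hx, hy]
      · simp [hmem, hx, hy]
      · simpa [hmem, hx, hy] using hclose x (hG j x hx) y (hG j y hy) hxy
    have hsum := Finset.sum_le_sum hlow
    rw [Finset.sum_sub_distrib, Finset.sum_ite_mem, Finset.inter_eq_right.2 (Finset.filter_subset _ _)]
      at hsum
    simp only [Finset.sum_const, Finset.card_range, nsmul_eq_mul] at hsum
    push_cast at hsum
    have hA' : (A.card : ℝ) ≤ 1 := by exact_mod_cast hA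
    rw [hκ, le_inv_mul_iff₀ hL0]
    refine le_trans ?_ hsum
    have h1 : 1 ≤ ε * ((L : ℝ) + 1) := by
      rw [div_lt_iff₀ hL0] at hL
      exact hL.le
    nlinarith [mul_le_mul_of_nonneg_right hA' (sub_nonneg.2 hε1)]

/-- If a finite set carries no localized kernel then, by the Hahn-Banach theorem, there is a
diagonal matrix that dominates locally, but not globally, a symmetric nonnegative matrix on it. -/
lemma exists_weights_of_not_hasLocalKernel {F : Finset X} {r S : ℝ≥0} {ε : ℝ} (hε : 0 < ε)
    (hF : ¬ HasLocalKernel (F : Set X) r S ε) :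
    ∃ (c : X → ℝ) (w : X → X → ℝ), (∀ x ∈ F, 0 ≤ c x) ∧ (∀ x y, w x y = w y x) ∧
      (∀ x y, 0 ≤ w x y) ∧ (∀ x, w x x = 0) ∧ (∀ x y, (r : ℝ≥0∞) < edist x y → w x y = 0) ∧
      (∀ s ⊆ F, (∀ x ∈ s, ∀ y ∈ s, edist x y ≤ S) → ∀ v : X → ℝ,
        ∑ x ∈ s, ∑ y ∈ s, w x y * v x * v y ≤ ∑ x ∈ s, c x * v x ^ 2) ∧
      (1 - ε / 4) * ∑ x ∈ F, c x < (1 - 3 * ε / 4) * ∑ x ∈ F, ∑ y ∈ F, w x y := by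
  classical
  let A : Set (X → X → ℝ) := {k | Matrix.PosSemidef (k : Matrix X X ℝ) ∧
    (∀ x y, (S : ℝ≥0∞) < edist x y → k x y = 0) ∧ ∀ x y, ¬ (x ∈ F ∧ y ∈ F) → k x y = 0}
  let P : Set (X → X → ℝ) := {k | (∀ x ∈ F, k x x < 1) ∧
    ∀ x ∈ F, ∀ y ∈ F, x ≠ y → edist x y ≤ r → 1 - ε < k x y}
  have hAsmul : ∀ k ∈ A, ∀ a : ℝ, 0 ≤ a → a • k ∈ A := by
    rintro k ⟨h1, h2, h3⟩ a ha
    exact ⟨Matrix.PosSemidef.smul h1 ha, fun x y h => by simp [h2 x y h],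
      fun x y h => by simp [h3 x y h]⟩
  have hAadd : ∀ k ∈ A, ∀ l ∈ A, k + l ∈ A := by
    rintro k ⟨h1, h2, h3⟩ l ⟨h1', h2', h3'⟩
    exact ⟨Matrix.PosSemidef.add h1 h1', fun x y h => by simp [h2 x y h, h2' x y h],
      fun x y h => by simp [h3 x y h, h3' x y h]⟩
  have hAconv : Convex ℝ A := fun k hk l hl a b ha hb _ =>
    hAadd _ (hAsmul k hk a ha) _ (hAsmul l hl b hb)
  have hA0 : (0 : X → X → ℝ) ∈ A := ⟨Matrix.PosSemidef.zero, by simp, by simp⟩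
  have hPconv : Convex ℝ P := by
    rintro k ⟨h1, h2⟩ l ⟨h1', h2'⟩ a b ha hb hab
    refine ⟨fun x hx => ?_, fun x hx y hy hxy hd => ?_⟩
    · exact convex_Iio (𝕜 := ℝ) (1 : ℝ) (h1 x hx) (h1' x hx) ha hb hab
    · exact convex_Ioi (𝕜 := ℝ) (1 - ε) (h2 x hx y hy hxy hd) (h2' x hx y hy hxy hd) ha hb hab
  have hPopen : IsOpen P := by
    have hc : ∀ x y, Continuous fun k : X → X → ℝ => k x y := fun x y =>
      (continuous_apply y).comp (continuous_apply x)
    have : P = (⋂ x ∈ F, {k | k x x < 1}) ∩ ⋂ x ∈ F, ⋂ y ∈ F,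
        {k : X → X → ℝ | x ≠ y → edist x y ≤ r → 1 - ε < k x y} := by
      ext k
      simp [P]
    rw [this]
    refine (isOpen_biInter_finset fun x _ => isOpen_lt (hc x x) continuous_const).inter
      (isOpen_biInter_finset fun x _ => isOpen_biInter_finset fun y _ => ?_)
    by_cases h : x ≠ y ∧ edist x y ≤ r
    · simpa [h.1, h.2] using isOpen_lt continuous_const (hc x y)
    · convert isOpen_univ
      ext k
      simp only [Set.mem_ofPred_eq, Set.mem_univ, iff_true]
      exact fun h1 h2 => absurd ⟨h1, h2⟩ h
  have hdisj : Disjoint P A := by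
    suffices h : ∀ k : Matrix X X ℝ, k ∈ P → k ∈ A → False from
      Set.disjoint_left.2 fun k hkP hkA => h k hkP hkA
    rintro k ⟨hk1, hk2⟩ ⟨hk3, hk4, hk5⟩
    -- Raising the diagonal on `F` to 1 preserves positivity and turns a common point into a
    -- forbidden local kernel.
    refine hF ⟨k + Matrix.diagonal fun x => if x ∈ F then 1 - k x x else 0,
      hk3.add (Matrix.PosSemidef.diagonal fun x => ?_), fun x => ?_, fun x y hxy => ?_,
      fun x hx y hy hxy => ?_⟩
    · by_cases hx : x ∈ F
      · simpa [hx] using (hk1 x hx).le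
      · simp [hx]
    · by_cases hx : x ∈ F
      · simp [hx]
      · simp [hx, hk5 x x (by simp [hx])]
    · have hne : x ≠ y := by
        rintro rfl
        simp at hxy
      simp [hne, hk4 x y hxy]
    · by_cases hne : x = y
      · subst hne
        have hx' : x ∈ F := hx
        simp [hx', hε.le]
      · simpa [hne] using (hk2 x hx y hy hne hxy).le
  obtain ⟨f, m, hfP, hfA⟩ := geometric_hahn_banach_open hPconv hPopen hAconv hdisj
  have hm : m ≤ 0 := by simpa using hfA 0 hA0
  have hfA0 : ∀ k ∈ A, 0 ≤ f k := by
    intro k hk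
    by_contra! hneg
    have h1 := hfA _ (hAsmul k hk ((m - 1) / f k) (div_nonneg_of_nonpos (by linarith) hneg.le))
    rw [map_smul, smul_eq_mul, div_mul_cancel₀ _ hneg.ne] at h1
    linarith
  let e : X → X → X → X → ℝ := fun x y => Pi.single x (Pi.single y 1)
  have he : ∀ x y a b, e x y a b = if a = x ∧ b = y then 1 else 0 := by
    intro x y a b
    by_cases hx : a = x
    · subst hx
      simp [e, Pi.single_apply]
    · simp [e, hx]
  let c : X → X → ℝ := fun x y => f (e x y)
  have hfc : ∀ k : X → X → ℝ, (∀ x y, ¬ (x ∈ F ∧ y ∈ F) → k x y = 0) →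
      f k = ∑ x ∈ F, ∑ y ∈ F, k x y * c x y := by
    intro k hk
    have : k = ∑ x ∈ F, ∑ y ∈ F, k x y • e x y := by
      ext a b
      simp only [Finset.sum_apply, Pi.smul_apply, he, smul_eq_mul, mul_ite, mul_one, mul_zero]
      by_cases ha : a ∈ F
      · rw [Finset.sum_eq_single_of_mem a ha fun x _ hx => by simp [Ne.symm hx]]
        by_cases hb : b ∈ F
        · rw [Finset.sum_eq_single_of_mem b hb fun x _ hx => by simp [Ne.symm hx]]
          simp
        · rw [hk a b (by simp [hb])]
          refine (Finset.sum_eq_zero fun y hy => ?_).symm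
          rw [if_neg]
          rintro ⟨-, rfl⟩
          exact hb hy
      · rw [hk a b (by simp [ha])]
        refine (Finset.sum_eq_zero fun x hx => Finset.sum_eq_zero fun y hy => ?_).symm
        rw [if_neg]
        rintro ⟨rfl, -⟩
        exact ha hx
    conv_lhs => rw [this]
    simp [c, map_sum]
  -- On symmetric kernels supported in `F`, the functional is the diagonal `c` minus the symmetrized
  -- off-diagonal part `w`.
  let w : X → X → ℝ := fun x y => if x = y then 0 else -((c x y + c y x) / 2)
  have hwsymm : ∀ x y, w x y = w y x := fun x y => by simp only [w, eq_comm, add_comm]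
  have hfw : ∀ k : X → X → ℝ, (∀ x y, k x y = k y x) → (∀ x y, ¬ (x ∈ F ∧ y ∈ F) → k x y = 0) →
      f k = ∑ x ∈ F, k x x * c x x - ∑ x ∈ F, ∑ y ∈ F, k x y * w x y := by
    intro k hs hk
    have h1 : ∑ x ∈ F, ∑ y ∈ F, k x y * c x y = ∑ x ∈ F, ∑ y ∈ F, k x y * ((c x y + c y x) / 2) := by
      have h2 : ∑ x ∈ F, ∑ y ∈ F, k x y * c x y = ∑ x ∈ F, ∑ y ∈ F, k x y * c y x := by
        rw [Finset.sum_comm]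
        exact Finset.sum_congr rfl fun x _ => Finset.sum_congr rfl fun y _ => by rw [hs]
      have h3 : ∑ x ∈ F, ∑ y ∈ F, k x y * ((c x y + c y x) / 2)
          = (∑ x ∈ F, ∑ y ∈ F, k x y * c x y + ∑ x ∈ F, ∑ y ∈ F, k x y * c y x) / 2 := by
        simp only [← Finset.sum_add_distrib, Finset.sum_div]
        exact Finset.sum_congr rfl fun x _ => Finset.sum_congr rfl fun y _ => by ring
      linarith
    rw [hfc k hk, h1, ← Finset.sum_sub_distrib]
    refine Finset.sum_congr rfl fun x hx => ?_
    have h4 : k x x * c x x = ∑ y ∈ F, if x = y then k x x * c x x else 0 := by simp [hx]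
    rw [h4, ← Finset.sum_sub_distrib]
    refine Finset.sum_congr rfl fun y _ => ?_
    by_cases hxy : x = y
    · subst hxy
      simp [w]
    · simp [w, hxy]
  -- A point of `P` with slack in both kinds of constraint; `f p < 0` is the final gap inequality.
  let p : X → X → ℝ := fun x y =>
    if x ∈ F ∧ y ∈ F then (if x = y then 1 - ε / 4 else 1 - 3 * ε / 4) else 0
  have hpP : p ∈ P := by
    refine ⟨fun x hx => ?_, fun x hx y hy hxy _ => ?_⟩
    · simp only [p, hx, and_self, if_true]
      linarith
    · simp only [p, hx, hy, hxy, and_self, if_true, if_false]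
      linarith
  -- `f` is bounded above on `P`, so it cannot increase along a ray inside `P`. Off-diagonal entries
  -- may always grow, and are unconstrained beyond distance `r`; this gives the sign and the support
  -- of `c`.
  have hray : ∀ q : X → X → ℝ, (∀ τ : ℝ, 0 ≤ τ → p + τ • q ∈ P) → f q ≤ 0 := by
    intro q hq
    by_contra! hpos
    have h0 := hfP p hpP
    have h1 := hfP _ (hq ((m - f p) / f q) (div_nonneg (by linarith) hpos.le))
    rw [map_add, map_smul, smul_eq_mul, div_mul_cancel₀ _ hpos.ne'] at h1
    linarith
  have hray_e : ∀ x y, x ≠ y → ∀ a : ℝ, (0 ≤ a ∨ (r : ℝ≥0∞) < edist x y) → f (a • e x y) ≤ 0 := by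
    intro x y hxy a ha
    refine hray _ fun τ hτ => ⟨fun z hz => ?_, fun z hz z' hz' hzz hd => ?_⟩
    · have : ¬ (z = x ∧ z = y) := fun h => hxy (h.1.symm.trans h.2)
      simpa [he, this] using hpP.1 z hz
    · have hp := hpP.2 z hz z' hz' hzz hd
      by_cases h : z = x ∧ z' = y
      · obtain ⟨rfl, rfl⟩ := h
        have ha' : 0 ≤ a := ha.resolve_right (not_lt.2 hd)
        have := mul_nonneg hτ ha'
        simp only [Pi.add_apply, Pi.smul_apply, he, smul_eq_mul, and_self, if_true]
        linarith
      · simpa [he, h] using hp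
  have hc_nonpos : ∀ x y, x ≠ y → c x y ≤ 0 := fun x y hxy => by
    simpa using hray_e x y hxy 1 (Or.inl zero_le_one)
  have hc_zero : ∀ x y, (r : ℝ≥0∞) < edist x y → c x y = 0 := fun x y hd => by
    have hxy : x ≠ y := by
      rintro rfl
      simp at hd
    refine le_antisymm (hc_nonpos x y hxy) ?_
    have := hray_e x y hxy (-1) (Or.inr hd)
    rw [map_smul, smul_eq_mul] at this
    change 0 ≤ f (e x y)
    linarith
  -- Test `f ≥ 0` on the rank one kernel `g x * g y`, which lies in `A` when `s` has diameter at
  -- most `S`.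
  have hrank : ∀ s ⊆ F, (∀ x ∈ s, ∀ y ∈ s, edist x y ≤ S) → ∀ v : X → ℝ,
      ∑ x ∈ s, ∑ y ∈ s, w x y * v x * v y ≤ ∑ x ∈ s, c x x * v x ^ 2 := by
    intro s hs hd v
    let g : X → ℝ := fun x => if x ∈ s then v x else 0
    have hgs : ∀ x ∉ s, g x = 0 := fun x hx => by simp [g, hx]
    have hsupp : ∀ x y, ¬ (x ∈ F ∧ y ∈ F) → g x * g y = 0 := by
      intro x y h
      by_cases hx : x ∈ F
      · rw [hgs y fun hy => h ⟨hx, hs hy⟩, mul_zero]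
      · rw [hgs x fun hx' => hx (hs hx'), zero_mul]
    have hmem : (fun x y => g x * g y) ∈ A := by
      refine ⟨?_, fun x y hxy => ?_, hsupp⟩
      · simpa using posSemidef_of_fibers (fun _ : X => ()) g
      · by_cases hx : x ∈ s
        · by_cases hy : y ∈ s
          · exact absurd hxy (not_lt.2 (hd x hx y hy))
          · change g x * g y = 0
            rw [hgs y hy, mul_zero]
        · change g x * g y = 0
          rw [hgs x hx, zero_mul]
    have h := hfA0 _ hmem
    rw [hfw _ (fun x y => mul_comm _ _) hsupp, sub_nonneg] at h
    have h1 : ∑ x ∈ F, g x * g x * c x x = ∑ x ∈ s, c x x * v x ^ 2 := by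
      rw [← Finset.sum_subset hs fun x _ hx => by rw [hgs x hx]; ring]
      exact Finset.sum_congr rfl fun x hx => by simp only [g, hx, if_true]; ring
    have h2 : ∑ x ∈ F, ∑ y ∈ F, g x * g y * w x y = ∑ x ∈ s, ∑ y ∈ s, w x y * v x * v y := by
      rw [← Finset.sum_subset hs fun x _ hx => by simp [hgs x hx]]
      refine Finset.sum_congr rfl fun x hx => ?_
      rw [← Finset.sum_subset hs fun y _ hy => by simp [hgs y hy]]
      exact Finset.sum_congr rfl fun y hy => by simp only [g, hx, hy, if_true]; ring
    linarith
  have hc_diag : ∀ x ∈ F, 0 ≤ c x x := by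
    intro x hx
    simpa [w] using hrank {x} (by simpa using hx) (by simp) fun _ => 1
  have hwnonneg : ∀ x y, 0 ≤ w x y := by
    intro x y
    by_cases hxy : x = y
    · simp [w, hxy]
    · simp only [w, hxy, if_false]
      linarith [hc_nonpos x y hxy, hc_nonpos y x (Ne.symm hxy)]
  refine ⟨fun x => c x x, w, hc_diag, hwsymm, hwnonneg, fun x => by simp [w], fun x y h => ?_,
    hrank, ?_⟩
  · simp [w, hc_zero x y h, hc_zero y x (by rwa [edist_comm])]
  · have h1 : f p < 0 := (hfP p hpP).trans_le hm
    rw [hfw p (fun x y => if_congr and_comm (if_congr eq_comm rfl rfl) rfl) fun x y h => by simp [p, h]] at h1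
    have h2 : ∑ x ∈ F, p x x * c x x = (1 - ε / 4) * ∑ x ∈ F, c x x := by
      rw [Finset.mul_sum]
      exact Finset.sum_congr rfl fun x hx => by simp [p, hx]
    have h3 : ∑ x ∈ F, ∑ y ∈ F, p x y * w x y = (1 - 3 * ε / 4) * ∑ x ∈ F, ∑ y ∈ F, w x y := by
      simp only [Finset.mul_sum]
      refine Finset.sum_congr rfl fun x hx => Finset.sum_congr rfl fun y hy => ?_
      by_cases hxy : x = y
      · simp [w, hxy]
      · simp [p, hx, hy, hxy]
    linarith

/-- If a finite set carries no localized kernel then, by the Hahn-Banach theorem, it carries a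
symmetric nonnegative matrix with small local numerical radius, but with norm greater than `1`. -/
lemma exists_matrix_of_not_hasLocalKernel {F : Finset X} {r S : ℝ≥0} {ε : ℝ} (hε : 0 < ε)
    (hε1 : ε ≤ 1) (hrS : r ≤ S) (hF : ¬ HasLocalKernel (F : Set X) r S ε) :
    ∃ t : X → X → ℝ, (∀ x y, t x y = t y x) ∧ (∀ x y, 0 ≤ t x y) ∧ (∀ x y, t x y ≤ 1) ∧
      (∀ x y, x ∉ F → t x y = 0) ∧ (∀ x y, (r : ℝ≥0∞) < edist x y → t x y = 0) ∧
      (∀ s ⊆ F, (∀ x ∈ s, ∀ y ∈ s, edist x y ≤ S) → ∀ v : X → ℝ,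
        ∑ x ∈ s, ∑ y ∈ s, t x y * v x * v y ≤ ∑ x ∈ s, v x ^ 2) ∧
      ∃ u : X → ℝ, 0 < ∑ x ∈ F, u x ^ 2 ∧
        (1 + ε / 2) * ∑ x ∈ F, u x ^ 2 ≤ ∑ x ∈ F, ∑ y ∈ F, t x y * u x * u y := by
  classical
  obtain ⟨c, w, hc_diag, hwsymm, hwnonneg, hwdiag, hwdist, hrank, hgap⟩ :=
    exists_weights_of_not_hasLocalKernel hε hF
  set W : ℝ := ∑ x ∈ F, ∑ y ∈ F, w x y with hW
  -- Some `c x` may vanish; part of the gap is spent on making all weights positive, so that one can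
  -- divide by them.
  set δ : ℝ := ((1 - 3 * ε / 4) * W - (1 - ε / 4) * ∑ x ∈ F, c x) / (F.card + 1) with hδ
  have hδ0 : 0 < δ := div_pos (by linarith) (by positivity)
  let d : X → ℝ := fun x => c x + δ
  have hd0 : ∀ x ∈ F, 0 < d x := fun x hx => add_pos_of_nonneg_of_pos (hc_diag x hx) hδ0
  have hFne : F.Nonempty := by
    rw [Finset.nonempty_iff_ne_empty]
    intro h
    rw [hW, h] at hgap
    simp at hgap
  have hdW : (1 + ε / 2) * ∑ x ∈ F, d x ≤ W := by
    have h1 : ∑ x ∈ F, d x = ∑ x ∈ F, c x + F.card * δ := by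
      simp [d, Finset.sum_add_distrib]
    have h2 : δ * (F.card + 1) = (1 - 3 * ε / 4) * W - (1 - ε / 4) * ∑ x ∈ F, c x :=
      div_mul_cancel₀ _ (by positivity)
    have hpos : 0 < ∑ x ∈ F, d x := Finset.sum_pos hd0 hFne
    have hcard : (0 : ℝ) ≤ F.card := by positivity
    have h3 : (1 - ε / 4) * ∑ x ∈ F, d x ≤ (1 - 3 * ε / 4) * W := by
      rw [h1]
      nlinarith [mul_nonneg hcard hδ0.le]
    have h4 : (1 - 3 * ε / 4) * ((1 + ε / 2) * ∑ x ∈ F, d x) ≤ (1 - 3 * ε / 4) * W := by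
      refine le_trans ?_ h3
      rw [← mul_assoc]
      gcongr
      nlinarith
    exact le_of_mul_le_mul_left h4 (by linarith)
  -- This is `D^(-1/2) w D^(-1/2)` for the diagonal `D` of `d`; the large vector is `√d`, where the
  -- form is `∑ w`.
  let t : X → X → ℝ := fun x y => if x ∈ F ∧ y ∈ F then w x y / (√(d x) * √(d y)) else 0
  have htloc : ∀ s ⊆ F, (∀ x ∈ s, ∀ y ∈ s, edist x y ≤ S) → ∀ v : X → ℝ,
      ∑ x ∈ s, ∑ y ∈ s, t x y * v x * v y ≤ ∑ x ∈ s, v x ^ 2 := by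
    intro s hs hd' v
    have h := hrank s hs hd' fun x => v x / √(d x)
    calc _ = ∑ x ∈ s, ∑ y ∈ s, w x y * (v x / √(d x)) * (v y / √(d y)) := by
          refine Finset.sum_congr rfl fun x hx => Finset.sum_congr rfl fun y hy => ?_
          simp only [t, hs hx, hs hy, and_self, if_true]
          ring
      _ ≤ _ := h
      _ ≤ _ := by
          refine Finset.sum_le_sum fun x hx => ?_
          have hx0 := hd0 x (hs hx)
          rw [div_pow, Real.sq_sqrt hx0.le, mul_div_assoc', div_le_iff₀ hx0, mul_comm]
          have : c x ≤ d x := by simp only [d]; linarith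
          gcongr
  have htdist : ∀ x y, (r : ℝ≥0∞) < edist x y → t x y = 0 := by
    intro x y h
    simp [t, hwdist x y h]
  have htdiag : ∀ x, t x x = 0 := fun x => by simp [t, hwdiag]
  have htsymm : ∀ x y, t x y = t y x := fun x y => by
    simp only [t]
    rw [hwsymm x y, mul_comm (√(d x))]
    exact if_congr and_comm rfl rfl
  refine ⟨t, htsymm, fun x y => ?_, fun x y => ?_, fun x y hx => by simp [t, hx], htdist, htloc,
    fun x => √(d x), ?_, ?_⟩
  · simp only [t]
    split_ifs
    · exact div_nonneg (hwnonneg x y) (by positivity)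
    · exact le_rfl
  · by_cases hxy : x = y
    · rw [hxy, htdiag]
      exact zero_le_one
    by_cases hdist : (r : ℝ≥0∞) < edist x y
    · rw [htdist x y hdist]
      exact zero_le_one
    by_cases hmem : x ∈ F ∧ y ∈ F
    · have hle : edist x y ≤ S := (not_lt.1 hdist).trans (by exact_mod_cast hrS)
      have h := htloc {x, y} (by simp [Finset.insert_subset_iff, hmem]) (by
        simp [hle, edist_comm y x]) fun _ => 1
      simp only [Finset.sum_pair hxy, htdiag, htsymm y x] at h
      linarith
    · simp [t, hmem]
  · exact Finset.sum_pos (fun x hx => by rw [Real.sq_sqrt (hd0 x hx).le]; exact hd0 x hx) hFne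
  · calc _ = (1 + ε / 2) * ∑ x ∈ F, d x := by
          congr 1
          exact Finset.sum_congr rfl fun x hx => Real.sq_sqrt (hd0 x hx).le
      _ ≤ W := hdW
      _ = _ := by
          refine Finset.sum_congr rfl fun x hx => Finset.sum_congr rfl fun y hy => ?_
          have hx0 : √(d x) ≠ 0 := (Real.sqrt_pos.2 (hd0 x hx)).ne'
          have hy0 : √(d y) ≠ 0 := (Real.sqrt_pos.2 (hd0 y hy)).ne'
          simp only [t, hx, hy, and_self, if_true]
          field_simp

end LocalKernels

/-! ### Cutting off a self-adjoint element of a C⋆-algebra -/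

section Cutoff

/-- The element `(a - κ)₊` of a C⋆-algebra: it is a polynomial limit in `a`, it is small where the
powers of `a` are small, and it dominates `a - κ`. -/
lemma exists_posPart_sub {A : Type*} [CStarAlgebra A] [PartialOrder A] [StarOrderedRing A] {a : A}
    (ha : IsSelfAdjoint a) {κ : ℝ} (hκ : 0 < κ) :
    ∃ b ∈ StarAlgebra.elemental ℂ a,
      (∀ m : ℕ, ∃ h : A, b = h * a ^ m ∧ ‖h‖ ≤ ‖a‖ * ‖(1 : A)‖ * (κ ^ m)⁻¹) ∧
      ∃ p : A, 0 ≤ p ∧ b = a - (κ : ℂ) • (1 : A) + p := by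
  refine ⟨cfc (fun t : ℝ => max (t - κ) 0) a, ?_, fun m => ?_,
    cfc (fun t : ℝ => max (κ - t) 0) a, cfc_nonneg fun t _ => le_max_right _ _, ?_⟩
  · rw [cfc_real_eq_complex]
    exact cfc_mem_elemental _ _
  · have hpos : ∀ t : ℝ, max t κ ^ m ≠ 0 := fun t =>
      pow_ne_zero _ (hκ.trans_le (le_max_right _ _)).ne'
    -- `max t κ` is invertible and agrees with `t` wherever `(t - κ)₊` is nonzero.
    have hcont : Continuous fun t : ℝ => max (t - κ) 0 * (max t κ ^ m)⁻¹ :=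
      (by fun_prop : Continuous fun t : ℝ => max (t - κ) 0).mul
        ((by fun_prop : Continuous fun t : ℝ => max t κ ^ m).inv₀ hpos)
    refine ⟨cfc (fun t : ℝ => max (t - κ) 0 * (max t κ ^ m)⁻¹) a, ?_,
      norm_cfc_le (by positivity) fun t ht => ?_⟩
    · rw [← cfc_pow_id (R := ℝ) a m, ← cfc_mul _ _ a hcont.continuousOn (by fun_prop)]
      refine cfc_congr fun t _ => ?_
      rcases le_total t κ with h | h
      · simp [sub_nonpos.2 h]
      · have := hpos t
        rw [max_eq_left h] at this
        simp only [max_eq_left h]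
        field_simp
    · have h1 : |t| ≤ ‖a‖ * ‖(1 : A)‖ := spectrum.norm_le_norm_mul_of_mem ht
      have h2 : (0 : ℝ) ≤ ‖a‖ * ‖(1 : A)‖ := by positivity
      rw [norm_mul, norm_inv, norm_pow, Real.norm_eq_abs, Real.norm_eq_abs,
        abs_of_nonneg (le_max_right _ _), abs_of_pos (hκ.trans_le (le_max_right _ _))]
      gcongr
      · exact max_le (by linarith [le_abs_self t]) h2
      · exact le_max_right _ _
  · have h1 : a - (κ : ℂ) • (1 : A) = cfc (fun t : ℝ => t - κ) a := by
      rw [cfc_sub _ _ a, cfc_id' ℝ a, cfc_const κ a]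
      simp [Algebra.algebraMap_eq_smul_one]
    rw [h1, ← cfc_add (a := a) (fun t : ℝ => t - κ) (fun t : ℝ => max (κ - t) 0)]
    refine cfc_congr fun t _ => ?_
    rcases le_total t κ with h | h
    · simp [h]
    · simp [h]

variable {E : Type*} [NormedAddCommGroup E] [InnerProductSpace ℂ E] [CompleteSpace E]

/-- By Bessel an orthonormal sequence is weakly null, so any norm limit of its images along a
subsequence is 0. -/
lemma exists_norm_lt_of_isCompactOperator_of_orthonormal {K : E →L[ℂ] E} (hK : IsCompactOperator K)
    {v : ℕ → E} (hv : Orthonormal ℂ v) {c : ℝ} (hc : 0 < c) : ∃ n, ‖K (v n)‖ < c := by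
  by_contra! h
  obtain ⟨C, hC, hsub⟩ := IsCompactOperator.image_closedBall_subset_compact
    (f := (K : E →ₗ[ℂ] E)) hK 1
  obtain ⟨w, -, φ, hφ, hw⟩ := hC.tendsto_subseq (x := fun n => K (v n)) fun n =>
    hsub ⟨v n, by simp [hv.1 n], rfl⟩
  have h1 : Tendsto (fun n => inner ℂ (K (v (φ n))) w) atTop (𝓝 (inner ℂ w w)) :=
    hw.inner tendsto_const_nhds
  have h2 : Tendsto (fun n => inner ℂ (v n) (ContinuousLinearMap.adjoint K w)) atTop (𝓝 0) := by
    rw [tendsto_zero_iff_norm_tendsto_zero]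
    have h3 := (hv.inner_products_summable (ContinuousLinearMap.adjoint K w)).tendsto_atTop_zero
    simpa using h3.sqrt
  have h3 : inner ℂ w w = (0 : ℂ) := tendsto_nhds_unique h1
    ((h2.comp hφ.tendsto_atTop).congr fun n => by
      simp [ContinuousLinearMap.adjoint_inner_right])
  have h4 : Tendsto (fun n => ‖K (v (φ n))‖) atTop (𝓝 0) := by
    rw [inner_self_eq_zero] at h3
    simpa [h3] using hw.norm
  exact absurd (ge_of_tendsto' h4 fun n => h (φ n)) (not_le.2 hc)

end Cutoff

/-! ### The uniform Roe algebra, and disjoint obstructions to property A -/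

section RoeAlgebra

variable {X : Type*} [EMetricSpace X]

/-- The star algebra of bounded operators of finite propagation. -/
def finitePropagation (X : Type*) [EMetricSpace X] : StarSubalgebra ℂ (L2 X →L[ℂ] L2 X) where
  carrier := ⋃ R : ℝ≥0, propagationLE X R
  mul_mem' := by
    intro S T hS hT
    obtain ⟨R₁, hS⟩ := Set.mem_iUnion.1 hS
    obtain ⟨R₂, hT⟩ := Set.mem_iUnion.1 hT
    refine Set.mem_iUnion.2 ⟨R₁ + R₂, mem_propagationLE_iff.2 fun x y hxy => ?_⟩
    rw [entry_eq_apply, mul_apply_eq_comp]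
    have hzero : ∀ z, T (dirac y) z * entry S x z = 0 := by
      intro z
      by_cases h1 : (R₁ : ℝ≥0∞) < edist x z
      · rw [mem_propagationLE_iff.1 hS x z h1, mul_zero]
      · have h2 : (R₂ : ℝ≥0∞) < edist z y := by
          by_contra h2
          refine absurd hxy (not_lt.2 ((edist_triangle x z y).trans ?_))
          push_cast
          exact add_le_add (not_lt.1 h1) (not_lt.1 h2)
        rw [← entry_eq_apply, mem_propagationLE_iff.1 hT z y h2, zero_mul]
    have h := hasSum_entry_mul S (T (dirac y)) x
    simp only [hzero] at h
    exact h.unique hasSum_zero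
  add_mem' := by
    intro S T hS hT
    obtain ⟨R₁, hS⟩ := Set.mem_iUnion.1 hS
    obtain ⟨R₂, hT⟩ := Set.mem_iUnion.1 hT
    refine Set.mem_iUnion.2 ⟨max R₁ R₂, mem_propagationLE_iff.2 fun x y hxy => ?_⟩
    have h1 : (R₁ : ℝ≥0∞) ≤ (max R₁ R₂ : ℝ≥0) := by exact_mod_cast le_max_left _ _
    have h2 : (R₂ : ℝ≥0∞) ≤ (max R₁ R₂ : ℝ≥0) := by exact_mod_cast le_max_right _ _
    rw [entry_add, mem_propagationLE_iff.1 hS x y (h1.trans_lt hxy),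
      mem_propagationLE_iff.1 hT x y (h2.trans_lt hxy), add_zero]
  algebraMap_mem' := by
    classical
    refine fun c => Set.mem_iUnion.2 ⟨0, mem_propagationLE_iff.2 fun x y hxy => ?_⟩
    have hne : x ≠ y := by
      rintro rfl
      simp at hxy
    simp [entry_eq_apply, Algebra.algebraMap_eq_smul_one, dirac_apply, hne]
  star_mem' := by
    intro T hT
    obtain ⟨R, hT⟩ := Set.mem_iUnion.1 hT
    refine Set.mem_iUnion.2 ⟨R, mem_propagationLE_iff.2 fun x y hxy => ?_⟩
    rw [entry_star, mem_propagationLE_iff.1 hT y x (by rwa [edist_comm]), map_zero]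

lemma elemental_subset_uniformRoe {T : L2 X →L[ℂ] L2 X} {R : ℝ≥0} (hT : T ∈ propagationLE X R) :
    (StarAlgebra.elemental ℂ T : Set (L2 X →L[ℂ] L2 X)) ⊆ uniformRoe X :=
  StarAlgebra.elemental.le_of_mem (S := (finitePropagation X).topologicalClosure)
    isClosed_closure (subset_closure (Set.mem_iUnion.2 ⟨R, hT⟩))

/-- If a space of bounded geometry lacks property A, then for some scale and some closeness there
are disjoint finite sets without kernels of larger and larger locality. -/
lemma BoundedGeometry.exists_disjoint_of_not_propertyA (hX : BoundedGeometry X)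
    (hA : ¬ PropertyA X) :
    ∃ (r : ℝ≥0) (ε : ℝ), 0 < ε ∧ ε ≤ 1 ∧ ∃ F : ℕ → Finset X,
      Pairwise (Function.onFun Disjoint F) ∧
      ∀ n : ℕ, ¬ HasLocalKernel (F n : Set X) r (r + n) ε := by
  classical
  have h1 : ∃ (r : ℝ≥0) (ε : ℝ), 0 < ε ∧ ∀ S, ¬ HasLocalKernel (Set.univ : Set X) r S ε := by
    by_contra! h
    exact hA (propertyA_of_hasLocalKernel h)
  obtain ⟨r, ε₀, hε₀, h1⟩ := h1
  -- Extending a kernel over a finite set doubles the closeness constant.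
  set ε := min (ε₀ / 2) 1 with hε
  have hε0 : 0 < ε := lt_min (by positivity) one_pos
  have h2 : ∀ (G : Finset X) (S : ℝ≥0), ∃ F : Finset X, Disjoint G F ∧
      ¬ HasLocalKernel (F : Set X) r S ε := by
    intro G S
    by_contra! h
    obtain ⟨S', k, hk⟩ := HasLocalKernel.univ_of_compl hX hε0 (min_le_right _ _)
      (hasLocalKernel_of_forall_finset fun F hF => h F (by
        rw [← Finset.disjoint_coe, Set.disjoint_left]
        exact fun x hx hxF => hF hxF hx))
    refine h1 S' ⟨k, hk.1, hk.2.1, hk.2.2.1, fun x hx y hy hxy => ?_⟩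
    have h3 := hk.2.2.2 x hx y hy hxy
    have h4 : ε ≤ ε₀ / 2 := min_le_left _ _
    linarith
  obtain ⟨f, hf, hrel⟩ := exists_seq_of_forall_finset_exists
    (fun q : ℕ × Finset X => ¬ HasLocalKernel (q.2 : Set X) r (r + q.1) ε)
    (fun q q' => q.1 < q'.1 ∧ Disjoint q.2 q'.2) (by
      intro s _
      obtain ⟨F, hF, hF'⟩ := h2 (s.biUnion Prod.snd) (r + (s.sup Prod.fst + 1 : ℕ))
      refine ⟨(s.sup Prod.fst + 1, F), hF', fun q hq => ⟨?_, ?_⟩⟩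
      · exact Nat.lt_succ_of_le (Finset.le_sup (f := Prod.fst) hq)
      · exact hF.mono_left (Finset.subset_biUnion_of_mem Prod.snd hq))
  have hmono : StrictMono fun n => (f n).1 := fun m n hmn => (hrel m n hmn).1
  refine ⟨r, ε, hε0, min_le_right _ _, fun n => (f n).2, ?_, fun n hn => hf n ?_⟩
  · intro m n hmn
    rcases lt_or_gt_of_ne hmn with h | h
    · exact (hrel m n h).2
    · exact (hrel n m h).2.symm
  · obtain ⟨k, hk, hdiag, hprop, hclose⟩ := hn
    refine ⟨k, hk, hdiag, fun x y hxy => hprop x y (lt_of_le_of_lt ?_ hxy), hclose⟩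
    have : (n : ℝ≥0) ≤ (f n).1 := by exact_mod_cast hmono.le_apply
    exact_mod_cast add_le_add_right this r

end RoeAlgebra

/-! ### Construction of a non-compact ghost -/

section Ghost

variable {X : Type*}

/-- Polarization: `4B(p, q) = B(p + q) - B(p - q)`. Nonnegative entries give `-B(p - q) ≤ B(|p -
q|)`, so a one-sided bound on the form suffices. -/
lemma sum_mul_mul_le_of_forall_sum_le {s : Finset X} {t : X → X → ℝ} (hsymm : ∀ x y, t x y = t y x)
    (hnonneg : ∀ x y, 0 ≤ t x y)
    (h : ∀ v : X → ℝ, ∑ x ∈ s, ∑ y ∈ s, t x y * v x * v y ≤ ∑ x ∈ s, v x ^ 2) (p q : X → ℝ) :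
    ∑ x ∈ s, ∑ y ∈ s, t x y * p x * q y ≤ (∑ x ∈ s, p x ^ 2 + ∑ x ∈ s, q x ^ 2) / 2 := by
  have h1 := h fun x => p x + q x
  have h2 := h fun x => |p x - q x|
  have h3 : -∑ x ∈ s, ∑ y ∈ s, t x y * (p x - q x) * (p y - q y)
      ≤ ∑ x ∈ s, ∑ y ∈ s, t x y * |p x - q x| * |p y - q y| := by
    simp only [← Finset.sum_neg_distrib]
    refine Finset.sum_le_sum fun x _ => Finset.sum_le_sum fun y _ => ?_
    rw [mul_assoc, mul_assoc, ← mul_neg, ← abs_mul]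
    exact mul_le_mul_of_nonneg_left (neg_le_abs _) (hnonneg x y)
  have h4 : ∑ x ∈ s, ∑ y ∈ s, t x y * q x * p y = ∑ x ∈ s, ∑ y ∈ s, t x y * p x * q y := by
    rw [Finset.sum_comm]
    exact Finset.sum_congr rfl fun x _ => Finset.sum_congr rfl fun y _ => by
      rw [hsymm]
      ring
  have h5 : ∑ x ∈ s, ∑ y ∈ s, t x y * (p x + q x) * (p y + q y)
      - ∑ x ∈ s, ∑ y ∈ s, t x y * (p x - q x) * (p y - q y)
      = 2 * ∑ x ∈ s, ∑ y ∈ s, t x y * p x * q y + 2 * ∑ x ∈ s, ∑ y ∈ s, t x y * q x * p y := by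
    simp only [← Finset.sum_sub_distrib, Finset.mul_sum, ← Finset.sum_add_distrib]
    exact Finset.sum_congr rfl fun x _ => Finset.sum_congr rfl fun y _ => by ring
  have h6 : ∑ x ∈ s, (p x + q x) ^ 2 + ∑ x ∈ s, |p x - q x| ^ 2
      = 2 * (∑ x ∈ s, p x ^ 2 + ∑ x ∈ s, q x ^ 2) := by
    simp only [sq_abs, ← Finset.sum_add_distrib, Finset.mul_sum]
    exact Finset.sum_congr rfl fun x _ => by ring
  linarith

lemma norm_inner_ofFinset_le {T : L2 X →L[ℂ] L2 X} {s : Finset X} {t : X → X → ℝ}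
    (hT : ∀ x ∈ s, ∀ y, entry T x y = t x y) (hsymm : ∀ x y, t x y = t y x)
    (hnonneg : ∀ x y, 0 ≤ t x y)
    (h : ∀ v : X → ℝ, ∑ x ∈ s, ∑ y ∈ s, t x y * v x * v y ≤ ∑ x ∈ s, v x ^ 2) (p q : X → ℂ) :
    ‖inner ℂ (ofFinset s p) (T (ofFinset s q))‖
      ≤ (‖ofFinset s p‖ ^ 2 + ‖ofFinset s q‖ ^ 2) / 2 := by
  rw [inner_ofFinset, norm_ofFinset_sq, norm_ofFinset_sq]
  refine le_trans (norm_sum_le_of_le _ fun x hx => norm_sum_le_of_le _ fun y _ => ?_)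
    (sum_mul_mul_le_of_forall_sum_le hsymm hnonneg h (fun x => ‖p x‖) fun x => ‖q x‖)
  rw [hT x hx y, norm_mul, norm_mul, RCLike.norm_conj, Complex.norm_real, Real.norm_eq_abs,
    abs_of_nonneg (hnonneg x y)]
  exact le_of_eq (by ring)

variable [EMetricSpace X]

/-- If a matrix supported on `F` has propagation at most `r` and numerical radius at most `1` on
localized vectors, then its powers up to the corresponding order do not increase the norms of the
Dirac masses. -/
lemma norm_pow_dirac_le_one {T : L2 X →L[ℂ] L2 X} {F : Finset X} {t : X → X → ℝ} {r S : ℝ≥0}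
    (hTt : ∀ x ∈ F, ∀ y, entry T x y = t x y) (hsymm : ∀ x y, t x y = t y x)
    (hTsymm : ∀ x y, entry T x y = starRingEnd ℂ (entry T y x))
    (hnonneg : ∀ x y, 0 ≤ t x y) (hsupp : ∀ x y, x ∉ F → t x y = 0)
    (hdist : ∀ x y, (r : ℝ≥0∞) < edist x y → t x y = 0)
    (hloc : ∀ s ⊆ F, (∀ x ∈ s, ∀ y ∈ s, edist x y ≤ S) → ∀ v : X → ℝ,
        ∑ x ∈ s, ∑ y ∈ s, t x y * v x * v y ≤ ∑ x ∈ s, v x ^ 2)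
    {x : X} (hx : x ∈ F) {m : ℕ} (hm : 2 * m * r ≤ S) : ‖(T ^ m) (dirac x)‖ ≤ 1 := by
  classical
  have hTt' : ∀ y ∈ F, ∀ z, entry T z y = t z y := by
    intro y hy z
    rw [hTsymm, hTt y hy, Complex.conj_ofReal, hsymm]
  -- `T ^ j δ_x` stays in `F` and within distance `j * r` of `x`.
  have hball : ∀ j : ℕ, ∀ y, y ∉ F ∨ (j * r : ℝ≥0∞) < edist y x → (T ^ j) (dirac x) y = 0 := by
    intro j
    induction j with
    | zero =>
      intro y hy
      have hne : y ≠ x := by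
        rintro rfl
        rcases hy with hy | hy
        · exact hy hx
        · simp at hy
      simp [dirac_apply, hne]
    | succ j ih =>
      intro y hy
      rw [pow_succ', mul_apply_eq_comp]
      have hzero : ∀ z, (T ^ j) (dirac x) z * entry T y z = 0 := by
        intro z
        by_cases hz : z ∉ F ∨ (j * r : ℝ≥0∞) < edist z x
        · rw [ih z hz, zero_mul]
        · rw [not_or, not_not, not_lt] at hz
          rw [hTt' z hz.1]
          rcases hy with hy | hy
          · rw [hsupp y z hy, Complex.ofReal_zero, mul_zero]
          · rw [hdist y z, Complex.ofReal_zero, mul_zero]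
            by_contra hyz
            refine absurd hy (not_lt.2 ((edist_triangle y z x).trans ?_))
            rw [Nat.cast_add, Nat.cast_one, add_mul, one_mul, add_comm]
            exact add_le_add hz.2 (not_lt.1 hyz)
      have h := hasSum_entry_mul T ((T ^ j) (dirac x)) y
      simp only [hzero] at h
      exact h.unique hasSum_zero
  set s : Finset X := F.filter fun y => edist y x ≤ m * (r : ℝ≥0∞) with hs
  have hsF : s ⊆ F := Finset.filter_subset _ _
  have hsdiam : ∀ y ∈ s, ∀ z ∈ s, edist y z ≤ S := by
    intro y hy z hz
    have hy' := (Finset.mem_filter.1 hy).2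
    have hz' := (Finset.mem_filter.1 hz).2
    rw [edist_comm] at hz'
    refine (edist_triangle y x z).trans ((add_le_add hy' hz').trans ?_)
    rw [← two_mul, ← mul_assoc]
    exact_mod_cast hm
  have hsupp' : ∀ j ≤ m, (T ^ j) (dirac x) = ofFinset s ((T ^ j) (dirac x)) := by
    intro j hj
    refine eq_ofFinset fun y hy => hball j y ?_
    rw [hs, Finset.mem_filter, not_and_or, not_le] at hy
    refine hy.imp_right fun h => lt_of_le_of_lt ?_ h
    gcongr
  have hstep : ∀ j ≤ m, ‖(T ^ j) (dirac x)‖ ≤ 1 := by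
    intro j
    induction j with
    | zero => simp
    | succ j ih =>
      intro hj
      have h1 := ih (Nat.le_of_succ_le hj)
      -- With `a j = ‖T ^ j δ_x‖`, the local bound gives `a (j + 1)² ≤ (a (j + 1)² + a j²) / 2`, so
      -- the norms do not increase.
      have h2 := norm_inner_ofFinset_le (fun y hy => hTt y (hsF hy)) hsymm hnonneg
        (hloc s hsF hsdiam) ((T ^ (j + 1)) (dirac x)) ((T ^ j) (dirac x))
      rw [← hsupp' (j + 1) hj, ← hsupp' j (Nat.le_of_succ_le hj), ← mul_apply_eq_comp,
        ← pow_succ', inner_self_eq_norm_sq_to_K, norm_pow, RCLike.norm_ofReal, abs_norm] at h2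
      have h3 : ‖(T ^ (j + 1)) (dirac x)‖ ^ 2 ≤ 1 := by
        have : ‖(T ^ j) (dirac x)‖ ^ 2 ≤ 1 := pow_le_one₀ (norm_nonneg _) h1
        linarith
      exact (sq_le_one_iff₀ (norm_nonneg _)).1 h3
  exact hstep m le_rfl

/-- A space of bounded geometry without property A has a non-compact ghost. -/
lemma BoundedGeometry.exists_isGhost_not_isCompactOperator (hX : BoundedGeometry X)
    (hA : ¬ PropertyA X) : ∃ T : L2 X →L[ℂ] L2 X, IsGhost T ∧ ¬ IsCompactOperator T := by
  classical
  obtain ⟨r, ε, hε, hε1, F, hdisj, hF⟩ := hX.exists_disjoint_of_not_propertyA hA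
  choose t hsymm hnonneg hle hsupp hdist hloc u hu0 hu using fun n =>
    exists_matrix_of_not_hasLocalKernel hε hε1 (le_add_of_nonneg_right zero_le) (hF n)
  let b : X → X → ℝ := fun x y => if h : ∃ n, x ∈ F n then t h.choose x y else 0
  have hb : ∀ n, ∀ x ∈ F n, ∀ y, b x y = t n x y := by
    intro n x hx y
    have h : ∃ n, x ∈ F n := ⟨n, hx⟩
    have hn : h.choose = n := by
      by_contra hne
      exact Finset.disjoint_left.1 (hdisj hne) h.choose_spec hx
    simp only [b, dif_pos h, hn]
  have hb0 : ∀ x y, (¬ ∃ n, x ∈ F n) → b x y = 0 := fun x y h => by simp only [b, dif_neg h]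
  have hbt : ∀ n, ∀ y ∈ F n, ∀ x, b x y = t n x y := by
    intro n y hy x
    by_cases hx : ∃ k, x ∈ F k
    · obtain ⟨k, hk⟩ := hx
      rcases eq_or_ne k n with rfl | hkn
      · exact hb k x hk y
      · rw [hb k x hk y, hsymm k, hsupp k y x fun hy' =>
          Finset.disjoint_left.1 (hdisj hkn) hy' hy, hsupp n x y fun hx' =>
          Finset.disjoint_left.1 (hdisj hkn) hk hx']
    · rw [hb0 x y hx, hsupp n x y fun h => hx ⟨n, h⟩]
  have hbsymm : ∀ x y, b x y = b y x := by
    intro x y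
    by_cases hx : ∃ n, x ∈ F n
    · obtain ⟨n, hn⟩ := hx
      rw [hb n x hn, hbt n x hn, hsymm]
    · by_cases hy : ∃ n, y ∈ F n
      · obtain ⟨n, hn⟩ := hy
        rw [hb n y hn, hbt n y hn, hsymm]
      · rw [hb0 x y hx, hb0 y x hy]
  obtain ⟨T, hTr, hT⟩ := hX.exists_operator (a := fun x y => (b x y : ℂ)) (R := r) (C := 1)
    (fun x y hxy => by
      by_cases hx : ∃ n, x ∈ F n
      · obtain ⟨n, hn⟩ := hx
        rw [hb n x hn, hdist n x y hxy, Complex.ofReal_zero]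
      · rw [hb0 x y hx, Complex.ofReal_zero])
    (fun x y => by
      rw [Complex.norm_real, Real.norm_eq_abs]
      by_cases hx : ∃ n, x ∈ F n
      · obtain ⟨n, hn⟩ := hx
        rw [hb n x hn, abs_of_nonneg (hnonneg n x y)]
        exact hle n x y
      · rw [hb0 x y hx, abs_zero]
        exact zero_le_one)
  have hTsymm : ∀ x y, entry T x y = starRingEnd ℂ (entry T y x) := fun x y => by
    rw [hT, hT, Complex.conj_ofReal, hbsymm]
  have hTF : ∀ n, ∀ x ∈ F n, ∀ y, entry T x y = t n x y := fun n x hx y => by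
    rw [hT, hb n x hx]
  have hsa : IsSelfAdjoint T := isSelfAdjoint_of_entry hTsymm
  -- Strictly between 1, the bound for powers on Dirac masses, and `1 + ε/2`, the size of the form
  -- at `u n`.
  set κ : ℝ := 1 + ε / 4 with hκ
  have hκ1 : 1 < κ := by linarith
  obtain ⟨G, hGmem, hGpow, P, hP, hGP⟩ := exists_posPart_sub hsa (zero_lt_one.trans hκ1)
  refine ⟨G, ⟨elemental_subset_uniformRoe hTr hGmem, ?_⟩, fun hcomp => ?_⟩
  · set C : ℝ := ‖T‖ * ‖(1 : L2 X →L[ℂ] L2 X)‖ with hC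
    have hC0 : 0 ≤ C := by positivity
    rw [Metric.tendsto_nhds]
    intro δ hδ
    have hlim : Tendsto (fun m : ℕ => C * (κ ^ m)⁻¹) atTop (𝓝 0) := by
      simpa using (tendsto_pow_atTop_atTop_of_one_lt hκ1).inv_tendsto_atTop.const_mul C
    obtain ⟨m, hm⟩ := (hlim.eventually (gt_mem_nhds hδ)).exists
    obtain ⟨H, hGH, hH⟩ := hGpow m
    obtain ⟨n₀, hn₀⟩ := exists_nat_ge (2 * m * r)
    have hpow : ∀ y, (∀ n < n₀, y ∉ F n) → ‖(T ^ m) (dirac y)‖ ≤ 1 := by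
      intro y hy
      by_cases hyF : ∃ n, y ∈ F n
      · obtain ⟨n, hn⟩ := hyF
        have hnn : n₀ ≤ n := not_lt.1 fun h => hy n h hn
        refine norm_pow_dirac_le_one (hTF n) (hsymm n) hTsymm (hnonneg n) (hsupp n) (hdist n)
          (hloc n) hn (hn₀.trans ?_)
        have : (n₀ : ℝ≥0) ≤ n := by exact_mod_cast hnn
        exact this.trans (le_add_of_nonneg_left zero_le)
      · rcases m with _ | m
        · simp
        · have hTy : T (dirac y) = 0 := by
            ext z
            rw [← entry_eq_apply, hT, hbsymm, hb0 y z hyF]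
            simp
          simp [pow_succ, hTy]
    have hfin : ∀ᶠ y in cofinite, ∀ n < n₀, y ∉ F n := by
      rw [eventually_cofinite]
      refine ((Finset.range n₀).biUnion F).finite_toSet.subset fun y hy => ?_
      simp only [Set.mem_ofPred_eq, not_forall, not_not] at hy
      obtain ⟨n, hn, hyn⟩ := hy
      simp only [Finset.coe_biUnion, Set.mem_iUnion]
      exact ⟨n, by simpa using hn, hyn⟩
    filter_upwards [(tendsto_snd (f := cofinite (α := X)) (g := cofinite (α := X))).eventually hfin]
      with q hq
    rw [dist_zero_right]
    calc ‖entry G q.1 q.2‖ ≤ ‖G (dirac q.2)‖ := norm_entry_le _ _ _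
      _ = ‖H ((T ^ m) (dirac q.2))‖ := by rw [hGH, mul_apply_eq_comp]
      _ ≤ ‖H‖ * ‖(T ^ m) (dirac q.2)‖ := H.le_opNorm _
      _ ≤ ‖H‖ * 1 := by gcongr; exact hpow _ hq
      _ < δ := by linarith
  · let w : ℕ → L2 X := fun n => ofFinset (F n) fun x => u n x
    have hw : ∀ n, ‖w n‖ ^ 2 = ∑ x ∈ F n, u n x ^ 2 := by
      intro n
      rw [norm_ofFinset_sq]
      exact Finset.sum_congr rfl fun x _ => by rw [Complex.norm_real, Real.norm_eq_abs, sq_abs]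
    have hw0 : ∀ n, 0 < ‖w n‖ := fun n => by
      have := hu0 n
      rw [← hw] at this
      exact (norm_nonneg _).lt_of_ne' fun h => by simp [h] at this
    have hinner : ∀ n, inner ℂ (w n) (T (w n))
        = ((∑ x ∈ F n, ∑ y ∈ F n, t n x y * u n x * u n y : ℝ) : ℂ) := by
      intro n
      rw [inner_ofFinset]
      push_cast
      refine Finset.sum_congr rfl fun x hx => Finset.sum_congr rfl fun y _ => ?_
      rw [hTF n x hx, Complex.conj_ofReal]
      ring
    -- `⟨w, G w⟩ ≥ ⟨w, T w⟩ - κ‖w‖² ≥ (ε/4)‖w‖²`.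
    have hbound : ∀ n, ε / 4 * ‖w n‖ ≤ ‖G (w n)‖ := by
      intro n
      have hPpos := ((ContinuousLinearMap.nonneg_iff_isPositive P).1 hP).re_inner_nonneg_right (w n)
      have hself : inner ℂ (w n) (w n) = ((‖w n‖ ^ 2 : ℝ) : ℂ) := by
        rw [inner_self_eq_norm_sq_to_K]
        simp
      have h1 : RCLike.re (inner ℂ (w n) (G (w n))) = (∑ x ∈ F n, ∑ y ∈ F n, t n x y * u n x * u n y)
          - κ * ‖w n‖ ^ 2 + RCLike.re (inner ℂ (w n) (P (w n))) := by
        rw [hGP]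
        simp only [add_apply, sub_apply, smul_apply, one_apply_eq_self, inner_add_right,
          inner_sub_right, inner_smul_right, map_add, map_sub, hinner, hself,
          ← Complex.ofReal_mul, RCLike.re_eq_complex_re, Complex.ofReal_re]
      have h2 : RCLike.re (inner ℂ (w n) (G (w n))) ≤ ‖w n‖ * ‖G (w n)‖ :=
        re_inner_le_norm _ _
      have h3 := hu n
      rw [← hw] at h3
      have h4 : ‖w n‖ * (ε / 4 * ‖w n‖) ≤ ‖w n‖ * ‖G (w n)‖ := by nlinarith
      exact le_of_mul_le_mul_left h4 (hw0 n)
    let v : ℕ → L2 X := fun n => ((‖w n‖⁻¹ : ℝ) : ℂ) • w n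
    have hv1 : ∀ n, ‖v n‖ = 1 := fun n => by
      simp only [v]
      rw [norm_smul, Complex.norm_real, norm_inv, norm_norm, inv_mul_cancel₀ (hw0 n).ne']
    have hv : Orthonormal ℂ v := by
      refine ⟨hv1, fun i j hij => ?_⟩
      simp only [v, inner_smul_left, inner_smul_right]
      have : inner ℂ (w i) (w j) = (0 : ℂ) := by
        rw [lp.inner_eq_tsum]
        refine (tsum_congr fun x => ?_).trans tsum_zero
        by_cases hx : x ∈ F i
        · have hx' : x ∉ F j := Finset.disjoint_left.1 (hdisj hij) hx
          simp [w, ofFinset_apply, hx']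
        · simp [w, ofFinset_apply, hx]
      simp [this]
    obtain ⟨n, hn⟩ := exists_norm_lt_of_isCompactOperator_of_orthonormal hcomp hv
      (show 0 < ε / 4 by positivity)
    refine absurd hn (not_lt.2 ?_)
    simp only [v, map_smul]
    rw [norm_smul, Complex.norm_real, norm_inv, norm_norm, le_inv_mul_iff₀ (hw0 n), mul_comm]
    exact hbound n

end Ghost

end RoeAlg

end

theorem theorem1p3 {X : Type*} [EMetricSpace X] (hX : RoeAlg.BoundedGeometry X) :
    (¬ RoeAlg.PropertyA X →
      ∃ T : RoeAlg.L2 X →L[ℂ] RoeAlg.L2 X, RoeAlg.IsGhost T ∧ ¬ IsCompactOperator T) ∧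
    (RoeAlg.PropertyA X ↔
      ∀ T : RoeAlg.L2 X →L[ℂ] RoeAlg.L2 X, RoeAlg.IsGhost T → IsCompactOperator T) := by
  have h : ¬ RoeAlg.PropertyA X →
      ∃ T : RoeAlg.L2 X →L[ℂ] RoeAlg.L2 X, RoeAlg.IsGhost T ∧ ¬ IsCompactOperator T :=
    hX.exists_isGhost_not_isCompactOperator
  refine ⟨h, fun hA T hT => hX.isCompactOperator_of_isGhost hA hT, fun hT => ?_⟩
  by_contra hA
  obtain ⟨T, hTg, hTc⟩ := h hA
  exact hTc (hT T hTg)
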